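/- All scalars are real. Let $M=(M,\mu)$ be a $\sigma$-finite measure space. A *measurable pseudometric* on $M$ is a map $\rho$ assigning to each pair of measurable sets of positive measure (modulo null sets) a value in $[0,\infty]$ such that $\rho(A,A)=0$, $\rho(A,B)=\rho(B,A)$, $\rho(\bigcup_n A_n,B)=\inf_n\rho(A_n,B)$ for countable unions, and $\rho(A,C)\le\sup_{B'\subset B}(\rho(A,B')+\rho(B',C))$ ($B'$ of positive measure). For $f\in L^\infty(M)$ let $\rho_f(A,B)$ be the distance in $\mathbb R$ between the essential ranges of $f|_A$ and $f|_B$, let $L(f)=\sup\{\rho_f(A,B)/\rho(A,B):\rho(A,B)>0\}$, and let $\mathrm{Lip}(M)=\{f\in L^\infty(M):L(f)<\infty\}$ with norm $\max(L(f),\|f\|_\infty)$. $\mathrm{Lip}(M)$ is a ring and a dual Banach space, whose weak* topology agrees on the unit ball with that of $L^\infty(M)=L^1(M)^*$. Assume that $\rho$ is a *measurable metric*, i.e. $\mathrm{Lip}(M)$ is weak*-dense in $L^\infty(M)$. An *abelian W\*-module* over $L^\infty(M)$ is a Banach module $E$ over $L^\infty(M)$ with $\|\phi\|=\max(\|p\phi\|,\|(1-p)\phi\|)$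 for all $\phi\in E$ and all projections $p\in L^\infty(M)$, which is a dual Banach space such that the product $L^\infty(M)\times E\to E$ is separately weak*-continuous. A *metric derivation* $\delta:\mathrm{Lip}(M)\to E$ is a bounded weak*-continuous linear map with $\delta(fg)=f\,\delta(g)+g\,\delta(f)$ for all $f,g\in\mathrm{Lip}(M)$. Let $\mathcal X(M)$ be the $L^\infty(M)$-module of all metric derivations $\mathrm{Lip}(M)\to L^\infty(M)$, with the operator norm, and let $\Omega(M)=\mathcal X(M)'$ be the module of all bounded $L^\infty(M)$-module maps $\mathcal X(M)\to L^\infty(M)$, with the operator norm and with the weak* topology given by the predual which is the closed linear span, in the Banach dual of $\Omega(M)$, of the functionals $\Phi\mapsto\int\Phi(\phi)g\,d\mu$ ($\phi\in\mathcal X(M)$, $g\in L^1(M)$). The *exterior derivative* $d:\mathrm{Lip}(M)\to\Omega(M)$ is $(df)(\phi)=\phi(f)$. **Theorem.** $\Omega(M)$ is an abelian W\*-module over $L^\infty(M)$ and $d:\mathrm{Lip}(M)\to\Omega(M)$ is a metric derivation. It is universal: for every abelian W\*-module $E$ over $L^\infty(M)$ and every metric derivation $\delta:\mathrm{Lip}(M)\to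 E$ there is a bounded weak*-continuous $L^\infty(M)$-module map $T:\Omega(M)\to E$ such that $\delta=T\circ d$ and $\|T\|=\|\delta\|$. -/

import Mathlib

open MeasureTheory Topology
open scoped ENNReal NNReal

namespace MeasMetric

universe u v

section Linfty

variable {M : Type u} [MeasurableSpace M]

/-- The real space `L^∞(M, μ)`, with the essential supremum norm. -/
def LInfty (μ : Measure M) : Type u := Lp ℝ ∞ μ

variable {μ : Measure M}

namespace LInfty

noncomputable instance instBase : NormedAddCommGroup (LInfty μ) :=
  inferInstanceAs (NormedAddCommGroup (Lp ℝ ∞ μ))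

noncomputable instance instNormedSpaceBase : NormedSpace ℝ (LInfty μ) :=
  inferInstanceAs (NormedSpace ℝ (Lp ℝ ∞ μ))

instance : CompleteSpace (LInfty μ) := inferInstanceAs (CompleteSpace (Lp ℝ ∞ μ))

/-- The underlying element of Mathlib's `Lp` space. -/
def asLp (f : LInfty μ) : Lp ℝ ∞ μ := f

/-- A (measurable) representative of an element of `L^∞`. -/
noncomputable instance : CoeFun (LInfty μ) (fun _ => M → ℝ) := ⟨fun f => (asLp f : M → ℝ)⟩

theorem memLp (f : LInfty μ) : MemLp (f : M → ℝ) ∞ μ := Lp.memLp (asLp f)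

theorem measurable_coe (f : LInfty μ) : Measurable (f : M → ℝ) :=
  (Lp.stronglyMeasurable (asLp f)).measurable

theorem ext {f g : LInfty μ} (h : (f : M → ℝ) =ᵐ[μ] g) : f = g := Lp.ext h

theorem coe_add (f g : LInfty μ) : ((f + g : LInfty μ) : M → ℝ) =ᵐ[μ] fun x => f x + g x :=
  Lp.coeFn_add (asLp f) g

theorem memLp_mul (f g : LInfty μ) : MemLp (fun x => f x * g x) ∞ μ :=
  MemLp.mul (p := ∞) (q := ∞) (memLp g) (memLp f)

/-- Multiplication of (classes of) bounded functions, almost everywhere pointwise. -/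
noncomputable instance : Mul (LInfty μ) := ⟨fun f g => (memLp_mul f g).toLp _⟩

/-- The constant function one. -/
noncomputable instance : One (LInfty μ) := ⟨(memLp_top_const (1 : ℝ)).toLp (fun _ : M => (1 : ℝ))⟩

theorem coe_mul (f g : LInfty μ) : ((f * g : LInfty μ) : M → ℝ) =ᵐ[μ] fun x => f x * g x :=
  MemLp.coeFn_toLp (memLp_mul f g)

theorem coe_one : ((1 : LInfty μ) : M → ℝ) =ᵐ[μ] fun _ => (1 : ℝ) :=
  MemLp.coeFn_toLp (memLp_top_const (1 : ℝ))

theorem coe_zero : ((0 : LInfty μ) : M → ℝ) =ᵐ[μ] fun _ => (0 : ℝ) :=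
  Lp.coeFn_zero ℝ ∞ μ

theorem ae_abs_le (f : LInfty μ) : ∀ᵐ x ∂μ, |f x| ≤ ‖f‖ := by
  have h := ae_le_eLpNormEssSup (f := (f : M → ℝ)) (μ := μ)
  have h2 : eLpNorm (f : M → ℝ) ∞ μ ≠ ∞ := (memLp f).2.ne
  filter_upwards [h] with x hx
  have h3 : ‖f‖ = (eLpNorm (f : M → ℝ) ∞ μ).toReal := Lp.norm_def (asLp f)
  rw [h3, eLpNorm_exponent_top]
  rw [eLpNorm_exponent_top] at h2
  have := ENNReal.toReal_mono h2 hx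
  simpa using this

theorem norm_le_of_ae {f : LInfty μ} {C : ℝ} (hC : 0 ≤ C) (h : ∀ᵐ x ∂μ, |f x| ≤ C) : ‖f‖ ≤ C := by
  have h3 : ‖f‖ = (eLpNorm (f : M → ℝ) ∞ μ).toReal := Lp.norm_def (asLp f)
  rw [h3, eLpNorm_exponent_top]
  exact ENNReal.toReal_le_of_le_ofReal hC (eLpNormEssSup_le_of_ae_bound h)

noncomputable instance instNormedCommRing : NormedCommRing (LInfty μ) :=
  { instBase (μ := μ) with
    mul := (· * ·)
    one := 1
    left_distrib := fun f g h => ext (by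
      filter_upwards [coe_mul f (g + h), coe_add g h, coe_add (f * g) (f * h), coe_mul f g,
        coe_mul f h] with x h1 h2 h3 h4 h5
      rw [h1, h2, h3, h4, h5]; ring)
    right_distrib := fun f g h => ext (by
      filter_upwards [coe_mul (f + g) h, coe_add f g, coe_add (f * h) (g * h), coe_mul f h,
        coe_mul g h] with x h1 h2 h3 h4 h5
      rw [h1, h2, h3, h4, h5]; ring)
    zero_mul := fun f => ext (by
      filter_upwards [coe_mul 0 f, coe_zero (μ := μ)] with x h1 h2
      rw [h1, h2]; ring)
    mul_zero := fun f => ext (by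
      filter_upwards [coe_mul f 0, coe_zero (μ := μ)] with x h1 h2
      rw [h1, h2]; ring)
    mul_assoc := fun f g h => ext (by
      filter_upwards [coe_mul (f * g) h, coe_mul f g, coe_mul f (g * h), coe_mul g h]
        with x h1 h2 h3 h4
      rw [h1, h2, h3, h4]; ring)
    one_mul := fun f => ext (by
      filter_upwards [coe_mul 1 f, coe_one (μ := μ)] with x h1 h2
      rw [h1, h2]; ring)
    mul_one := fun f => ext (by
      filter_upwards [coe_mul f 1, coe_one (μ := μ)] with x h1 h2
      rw [h1, h2]; ring)
    mul_comm := fun f g => ext (by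
      filter_upwards [coe_mul f g, coe_mul g f] with x h1 h2
      rw [h1, h2]; ring)
    norm_mul_le := fun f g => norm_le_of_ae (mul_nonneg (norm_nonneg _) (norm_nonneg _)) (by
      filter_upwards [coe_mul f g, ae_abs_le f, ae_abs_le g] with x h1 h2 h3
      rw [h1, abs_mul]
      exact mul_le_mul h2 h3 (abs_nonneg _) (norm_nonneg _)) }

theorem coe_smul (c : ℝ) (f : LInfty μ) :
    ((c • f : LInfty μ) : M → ℝ) =ᵐ[μ] fun x => c * f x :=
  Lp.coeFn_smul c (asLp f)

noncomputable instance instAlgebra : Algebra ℝ (LInfty μ) :=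
  Algebra.ofModule
    (fun c f g => ext (by
      filter_upwards [coe_mul (c • f) g, coe_smul c f, coe_smul c (f * g), coe_mul f g]
        with x h1 h2 h3 h4
      rw [h1, h2, h3, h4]; ring))
    (fun c f g => ext (by
      filter_upwards [coe_mul f (c • g), coe_smul c g, coe_smul c (f * g), coe_mul f g]
        with x h1 h2 h3 h4
      rw [h1, h2, h3, h4]; ring))

noncomputable instance instNormedAlgebra : NormedAlgebra ℝ (LInfty μ) where
  norm_smul_le c f := (norm_smul c (asLp f)).le

theorem integrable_mul (f : LInfty μ) (g : Lp ℝ 1 μ) : Integrable (fun x => f x * g x) μ :=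
  memLp_one_iff_integrable.1 (MemLp.mul (p := ∞) (q := 1) (Lp.memLp g) (memLp f))

end LInfty

end Linfty

section Weak

/-- The weak* topology on `E` relative to a space `P` of bounded linear functionals on `E`:
the coarsest topology making every member of `P` continuous. -/
abbrev weakStar {E : Type v} [NormedAddCommGroup E] [NormedSpace ℝ E]
    (P : Submodule ℝ (StrongDual ℝ E)) : TopologicalSpace E :=
  TopologicalSpace.induced (fun (e : E) (p : P) => (p : StrongDual ℝ E) e) inferInstance

theorem continuous_weakStar_iff {E : Type v} [NormedAddCommGroup E] [NormedSpace ℝ E]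
    {P : Submodule ℝ (StrongDual ℝ E)} {X : Type u} {t : TopologicalSpace X} {g : X → E} :
    Continuous[t, weakStar P] g ↔ ∀ p ∈ P, Continuous (fun x => p (g x)) := by
  rw [weakStar, continuous_induced_rng, continuous_pi_iff]
  simp

/-- `P` is a predual of `E` (so that `E` is a dual Banach space): `P` is a norm-closed subspace of
the dual of `E`, and evaluation is an isometric isomorphism of `E` onto the Banach space dual of
`P`. Every isometric isomorphism of `E` with the dual of a Banach space arises in this way. -/
structure IsPredual {E : Type v} [NormedAddCommGroup E] [NormedSpace ℝ E]
    (P : Submodule ℝ (StrongDual ℝ E)) : Prop where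
  isClosed : IsClosed (P : Set (StrongDual ℝ E))
  isometric : ∀ e : E, IsLUB {r : ℝ | ∃ p ∈ P, ‖p‖ ≤ 1 ∧ r = |p e|} ‖e‖
  surjective : ∀ ξ : P →ₗ[ℝ] ℝ, (∃ C : ℝ, ∀ p : P, |ξ p| ≤ C * ‖(p : StrongDual ℝ E)‖) →
    ∃ e : E, ∀ p : P, ξ p = (p : StrongDual ℝ E) e

variable {M : Type u} [MeasurableSpace M]

/-- The predual `L^1` of `L^∞`: the functionals `f ↦ ∫ f g dμ` with `g ∈ L^1`. -/
def linftyPredual (μ : Measure M) : Submodule ℝ (StrongDual ℝ (LInfty μ)) where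
  carrier := {p | ∃ g : Lp ℝ 1 μ, ∀ f : LInfty μ, p f = ∫ x, f x * g x ∂μ}
  zero_mem' := ⟨0, fun f => by
    have : (fun x => f x * (0 : Lp ℝ 1 μ) x) =ᵐ[μ] fun _ => 0 := by
      filter_upwards [Lp.coeFn_zero ℝ 1 μ] with x hx
      rw [hx]; simp
    rw [integral_congr_ae this]; simp⟩
  add_mem' := by
    rintro p q ⟨g, hg⟩ ⟨h, hh⟩
    refine ⟨g + h, fun f => ?_⟩
    have : (fun x => f x * (g + h : Lp ℝ 1 μ) x) =ᵐ[μ] fun x => f x * g x + f x * h x := by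
      filter_upwards [Lp.coeFn_add g h] with x hx
      rw [hx, Pi.add_apply]; ring
    rw [integral_congr_ae this,
      integral_add (LInfty.integrable_mul f g) (LInfty.integrable_mul f h), ← hg, ← hh]
    rfl
  smul_mem' := by
    rintro c p ⟨g, hg⟩
    refine ⟨c • g, fun f => ?_⟩
    have : (fun x => f x * (c • g : Lp ℝ 1 μ) x) =ᵐ[μ] fun x => c * (f x * g x) := by
      filter_upwards [Lp.coeFn_smul c g] with x hx
      rw [hx, Pi.smul_apply, smul_eq_mul]; ring
    rw [integral_congr_ae this, integral_const_mul, ← hg]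
    rfl

/-- The predual of `L^∞` is stable under multiplication by elements of `L^∞`. -/
theorem exists_linftyPredual_mul {μ : Measure M} (h : LInfty μ) {p : StrongDual ℝ (LInfty μ)}
    (hp : p ∈ linftyPredual μ) : ∃ q ∈ linftyPredual μ, ∀ f : LInfty μ, q f = p (h * f) := by
  obtain ⟨g, hg⟩ := hp
  refine ⟨p.comp (ContinuousLinearMap.mul ℝ (LInfty μ) h),
    ⟨(memLp_one_iff_integrable.2 (LInfty.integrable_mul h g)).toLp _, fun f => ?_⟩, fun f => rfl⟩
  change p (h * f) = _
  rw [hg]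
  refine integral_congr_ae ?_
  filter_upwards [LInfty.coe_mul h f,
    MemLp.coeFn_toLp (memLp_one_iff_integrable.2 (LInfty.integrable_mul h g))] with x h1 h2
  rw [h1, h2]; ring

/-- An abelian W*-module over `L^∞(μ)`: a Banach module `E` over `L^∞(μ)` which is
`L^∞(μ)`-normed, i.e. `‖φ‖ = max (‖p φ‖, ‖(1 - p) φ‖)` for all projections `p`, and which is a dual
Banach space (with predual `P`) such that the product is separately weak*-continuous. -/
structure IsAbelianWStarModule (μ : Measure M) {E : Type v} [NormedAddCommGroup E]
    [NormedSpace ℝ E] [Module (LInfty μ) E] (P : Submodule ℝ (StrongDual ℝ E)) : Prop where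
  isScalarTower : IsScalarTower ℝ (LInfty μ) E
  completeSpace : CompleteSpace E
  norm_smul_le : ∀ (f : LInfty μ) (φ : E), ‖f • φ‖ ≤ ‖f‖ * ‖φ‖
  norm_eq_max : ∀ p : LInfty μ, p * p = p → ∀ φ : E, ‖φ‖ = max ‖p • φ‖ ‖(1 - p) • φ‖
  isPredual : IsPredual P
  continuous_smul_left : ∀ φ : E,
    Continuous[weakStar (linftyPredual μ), weakStar P] fun f : LInfty μ => f • φ
  continuous_smul_right : ∀ f : LInfty μ,
    Continuous[weakStar P, weakStar P] fun φ : E => f • φ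

/-- The bounded `L^∞(μ)`-module homomorphisms from `E` to `L^∞(μ)`. -/
def dualSubmodule (μ : Measure M) (E : Type v) [NormedAddCommGroup E] [NormedSpace ℝ E]
    [Module (LInfty μ) E] : Submodule (LInfty μ) (E →L[ℝ] LInfty μ) where
  carrier := {Φ | ∀ (f : LInfty μ) (φ : E), Φ (f • φ) = f * Φ φ}
  zero_mem' := fun f φ => by simp
  add_mem' := fun {Φ Ψ} hΦ hΨ f φ => by
    rw [add_apply, hΦ f φ, hΨ f φ, add_apply, mul_add]
  smul_mem' := fun h Φ hΦ f φ => by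
    rw [smul_apply, hΦ f φ, smul_apply, smul_eq_mul, smul_eq_mul, mul_left_comm]

/-- The dual module `E'` of a module `E` over `L^∞(μ)`: the bounded `L^∞(μ)`-module
homomorphisms from `E` to `L^∞(μ)`, with the operator norm and the action `(f Φ)(φ) = f Φ(φ)`. -/
def DualModule (μ : Measure M) (E : Type v) [NormedAddCommGroup E] [NormedSpace ℝ E]
    [Module (LInfty μ) E] : Type (max u v) := dualSubmodule μ E

namespace DualModule

variable {μ : Measure M} {E : Type v} [NormedAddCommGroup E] [NormedSpace ℝ E]
  [Module (LInfty μ) E]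

noncomputable instance : NormedAddCommGroup (DualModule μ E) :=
  inferInstanceAs (NormedAddCommGroup (dualSubmodule μ E))

noncomputable instance : NormedSpace ℝ (DualModule μ E) :=
  inferInstanceAs (NormedSpace ℝ (dualSubmodule μ E))

noncomputable instance : Module (LInfty μ) (DualModule μ E) :=
  inferInstanceAs (Module (LInfty μ) (dualSubmodule μ E))

/-- The underlying bounded linear map of a member of the dual module. -/
def toCLM (Φ : DualModule μ E) : E →L[ℝ] LInfty μ :=
  Subtype.val (p := fun Ψ => Ψ ∈ dualSubmodule μ E) Φ

/-- The canonical predual of the dual module `E'`: the closed linear span of the functionals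
`Φ ↦ ∫ Φ(φ) g dμ` with `φ ∈ E` and `g ∈ L^1`. -/
noncomputable def predual (μ : Measure M) (E : Type v) [NormedAddCommGroup E] [NormedSpace ℝ E]
    [Module (LInfty μ) E] : Submodule ℝ (StrongDual ℝ (DualModule μ E)) :=
  (Submodule.span ℝ {ℓ : StrongDual ℝ (DualModule μ E) | ∃ φ : E, ∃ p ∈ linftyPredual μ,
    ∀ Φ : DualModule μ E, ℓ Φ = p (Φ.toCLM φ)}).topologicalClosure

end DualModule

end Weak

section Metric

variable {M : Type u} [MeasurableSpace M]

/-- Measurable sets of positive measure. Everything below respects equality up to null sets. -/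
abbrev PosSet (μ : Measure M) : Type u := {A : Set M // MeasurableSet A ∧ μ A ≠ 0}

/-- A measurable pseudometric on `(M, μ)`: a `[0, ∞]`-valued distance between positive measure sets
modulo null sets. -/
structure MeasurablePseudometric (μ : Measure M) where
  dist : PosSet μ → PosSet μ → ℝ≥0∞
  dist_congr : ∀ A A' B B' : PosSet μ, A.1 =ᵐ[μ] A'.1 → B.1 =ᵐ[μ] B'.1 → dist A B = dist A' B'
  dist_self : ∀ A, dist A A = 0
  dist_comm : ∀ A B, dist A B = dist B A
  dist_iUnion : ∀ (A : ℕ → PosSet μ) (U B : PosSet μ), U.1 = ⋃ n, (A n).1 →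
    dist U B = ⨅ n, dist (A n) B
  dist_triangle : ∀ A B C : PosSet μ,
    dist A C ≤ ⨆ B' : {B' : PosSet μ // B'.1 ⊆ B.1}, (dist A B'.1 + dist B'.1 C)

/-- The essential range of `f` restricted to `A`. -/
def essRangeOn (μ : Measure M) (f : M → ℝ) (A : Set M) : Set ℝ :=
  {a | ∀ U ∈ 𝓝 a, μ (A ∩ f ⁻¹' U) ≠ 0}

/-- The distance in `ℝ` between the essential ranges of `f|_A` and `f|_B`. -/
noncomputable def rangeDist (μ : Measure M) (f : M → ℝ) (A B : Set M) : ℝ≥0∞ :=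
  ⨅ a ∈ essRangeOn μ f A, ⨅ b ∈ essRangeOn μ f B, edist a b

variable {μ : Measure M}

namespace MeasurablePseudometric

variable (ρ : MeasurablePseudometric μ)

/-- The Lipschitz number of `f`. -/
noncomputable def lipNumber (f : M → ℝ) : ℝ≥0∞ :=
  ⨆ (A : PosSet μ) (B : PosSet μ) (_ : 0 < ρ.dist A B), rangeDist μ f A B / ρ.dist A B

end MeasurablePseudometric

theorem essRangeOn_nonempty {f : M → ℝ} (hf : Measurable f) {A : Set M} (hA : μ A ≠ 0) :
    (essRangeOn μ f A).Nonempty := by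
  by_contra hne
  apply hA
  have hf' : AEMeasurable f (μ.restrict A) := hf.aemeasurable
  have key : (Measure.map f (μ.restrict A)) Set.univ = 0 := by
    refine measure_null_of_locally_null _ fun a _ => ?_
    have ha : a ∉ essRangeOn μ f A := fun h => hne ⟨a, h⟩
    simp only [essRangeOn, Set.mem_ofPred_eq, not_forall, not_not] at ha
    obtain ⟨U, hU, h0⟩ := ha
    refine ⟨interior U, mem_nhdsWithin_of_mem_nhds (interior_mem_nhds.2 hU), ?_⟩
    rw [Measure.map_apply hf isOpen_interior.measurableSet,
      Measure.restrict_apply (hf isOpen_interior.measurableSet)]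
    refine measure_mono_null ?_ h0
    rintro x ⟨h1, h2⟩
    exact ⟨h2, interior_subset (s := U) h1⟩
  rw [Measure.map_apply hf MeasurableSet.univ] at key
  simpa using key

theorem abs_sub_le_of_mem_essRangeOn {f : M → ℝ} {A : Set M} {δ : ℝ}
    (h : ∀ x ∈ A, ∀ y ∈ A, |f x - f y| ≤ δ) {a : ℝ} (ha : a ∈ essRangeOn μ f A) {x : M}
    (hx : x ∈ A) : |a - f x| ≤ δ := by
  by_contra hlt
  push Not at hlt
  have hU : {u : ℝ | δ < |u - f x|} ∈ 𝓝 a :=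
    (isOpen_lt continuous_const (by fun_prop)).mem_nhds hlt
  refine ha _ hU ?_
  convert measure_empty (μ := μ)
  ext y
  simp only [Set.mem_inter_iff, Set.mem_preimage, Set.mem_ofPred_eq, Set.mem_empty_iff_false,
    iff_false, not_and, not_lt]
  exact fun hy => h y hy x hx

theorem essRangeOn_mono {f : M → ℝ} {A B : Set M} (h : A ⊆ B) :
    essRangeOn μ f A ⊆ essRangeOn μ f B := fun _ ha U hU h0 =>
  ha U hU (measure_mono_null (Set.inter_subset_inter_left _ h) h0)

namespace MeasurablePseudometric

variable (ρ : MeasurablePseudometric μ)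

theorem dist_anti_left {A' A : PosSet μ} (h : A'.1 ⊆ A.1) (B : PosSet μ) :
    ρ.dist A B ≤ ρ.dist A' B := by
  rw [ρ.dist_iUnion (fun n => if n = 0 then A else A') A B]
  · exact (iInf_le _ 1).trans (by simp)
  · apply Set.Subset.antisymm
    · exact fun x hx => Set.mem_iUnion.2 ⟨0, by simpa using hx⟩
    · refine Set.iUnion_subset fun n => ?_
      by_cases hn : n = 0
      · simp [hn]
      · simpa [hn] using h

theorem exists_piece {ι : Type} [Countable ι] {T : ι → Set M} (hT : ∀ i, MeasurableSet (T i))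
    (hcov : μ (⋃ i, T i)ᶜ = 0) (A B : PosSet μ) {r : ℝ≥0∞} (hr : ρ.dist A B < r) :
    ∃ (i : ι) (A' : PosSet μ), A'.1 = A.1 ∩ T i ∧ ρ.dist A' B < r := by
  classical
  let J := {i : ι // μ (A.1 ∩ T i) ≠ 0}
  have hnull : μ (A.1 \ ⋃ j : J, (A.1 ∩ T j.1)) = 0 := by
    have hbad : μ (⋃ i : {i : ι // μ (A.1 ∩ T i) = 0}, (A.1 ∩ T i.1)) = 0 :=
      measure_iUnion_null fun i => i.2
    refine measure_mono_null ?_ (measure_union_null hcov hbad)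
    rintro x ⟨hxA, hx⟩
    by_cases hxT : x ∈ ⋃ i, T i
    · right
      obtain ⟨i, hi⟩ := Set.mem_iUnion.1 hxT
      by_cases h0 : μ (A.1 ∩ T i) = 0
      · exact Set.mem_iUnion.2 ⟨⟨i, h0⟩, hxA, hi⟩
      · have hxJ : x ∈ ⋃ j : J, (A.1 ∩ T j.1) := Set.mem_iUnion.2 ⟨(⟨i, h0⟩ : J), hxA, hi⟩
        exact absurd hxJ hx
    · exact Or.inl hxT
  have hUA : (⋃ j : J, (A.1 ∩ T j.1)) ⊆ A.1 := Set.iUnion_subset fun j => Set.inter_subset_left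
  have hae : A.1 =ᵐ[μ] (⋃ j : J, (A.1 ∩ T j.1)) := by
    refine Filter.EventuallyLE.antisymm ?_ hUA.eventuallyLE
    exact ae_le_set.2 hnull
  have hUpos : μ (⋃ j : J, (A.1 ∩ T j.1)) ≠ 0 := by
    rw [← measure_congr hae]; exact A.2.2
  have hne : Nonempty J := by
    by_contra hemp
    rw [not_nonempty_iff] at hemp
    exact hUpos (by simp)
  obtain ⟨e, he⟩ := exists_surjective_nat J
  let U : PosSet μ := ⟨⋃ j : J, (A.1 ∩ T j.1),
    MeasurableSet.iUnion fun j => A.2.1.inter (hT _), hUpos⟩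
  let P : J → PosSet μ := fun j => ⟨A.1 ∩ T j.1, A.2.1.inter (hT _), j.2⟩
  have h1 : ρ.dist A B = ρ.dist U B := ρ.dist_congr A U B B hae Filter.EventuallyEq.rfl
  rw [h1, ρ.dist_iUnion (fun n => P (e n)) U B (he.iUnion_comp fun j => (P j).1).symm,
    iInf_lt_iff] at hr
  obtain ⟨n, hn⟩ := hr
  exact ⟨(e n).1, P (e n), rfl, hn⟩

theorem rangeDist_le_mul {f : M → ℝ} {A B : PosSet μ}
    (h0 : 0 < ρ.dist A B) (h1 : ρ.dist A B ≠ ∞) :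
    rangeDist μ f A B ≤ ρ.lipNumber f * ρ.dist A B := by
  rw [← ENNReal.div_le_iff h0.ne' h1]
  exact le_iSup_of_le A (le_iSup_of_le B (le_iSup_of_le h0 le_rfl))

/-- Comparison principle for Lipschitz numbers. -/
theorem lipNumber_le_of_abs_sub_le {f g h : M → ℝ} (mf : Measurable f) (mg : Measurable g)
    (mh : Measurable h) {S : Set M} (hS : ∀ᵐ x ∂μ, x ∈ S) {K L : ℝ≥0}
    (H : ∀ x ∈ S, ∀ y ∈ S, |h x - h y| ≤ K * |f x - f y| + L * |g x - g y|)
    (hf : ρ.lipNumber f ≠ ∞) (hg : ρ.lipNumber g ≠ ∞) :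
    ρ.lipNumber h ≤ K * ρ.lipNumber f + L * ρ.lipNumber g := by
  refine iSup_le fun A => iSup_le fun B => iSup_le fun h0 => ?_
  by_cases hd : ρ.dist A B = ∞
  · simp [hd]
  rw [ENNReal.div_le_iff h0.ne' hd]
  obtain ⟨lf, hlf⟩ : ∃ t : ℝ≥0, ρ.lipNumber f = t := ⟨_, (ENNReal.coe_toNNReal hf).symm⟩
  obtain ⟨lg, hlg⟩ : ∃ t : ℝ≥0, ρ.lipNumber g = t := ⟨_, (ENNReal.coe_toNNReal hg).symm⟩
  obtain ⟨d, hd'⟩ : ∃ t : ℝ≥0, ρ.dist A B = t := ⟨_, (ENNReal.coe_toNNReal hd).symm⟩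
  rw [hlf, hlg, hd']
  -- it suffices to prove the inequality up to an arbitrarily small error
  suffices hmain : ∀ δ : ℝ≥0, 0 < δ → rangeDist μ h A B ≤
      ((K * lf + L * lg) * d + δ * (K * (lf + 2) + L * (lg + 2) + 2) : ℝ≥0) by
    have hlim : Filter.Tendsto (fun δ : ℝ≥0 =>
        (((K * lf + L * lg) * d + δ * (K * (lf + 2) + L * (lg + 2) + 2) : ℝ≥0) : ℝ≥0∞))
        (𝓝[>] 0) (𝓝 (((K * lf + L * lg) * d : ℝ≥0) : ℝ≥0∞)) := by
      have hc : Continuous (fun δ : ℝ≥0 =>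
        (((K * lf + L * lg) * d + δ * (K * (lf + 2) + L * (lg + 2) + 2) : ℝ≥0) : ℝ≥0∞)) := by
        refine ENNReal.continuous_coe.comp ?_
        fun_prop
      have := hc.tendsto 0
      simp only [zero_mul, add_zero] at this
      exact this.mono_left nhdsWithin_le_nhds
    have := ge_of_tendsto hlim (by
      filter_upwards [self_mem_nhdsWithin] with δ hδ using hmain δ hδ)
    exact_mod_cast this
  intro δ hδ
  have hδ' : (0 : ℝ) < δ := hδ
  -- a countable partition into pieces on which `f`, `g`, `h` are nearly constant
  obtain ⟨N, hN, mN, hN0⟩ := exists_measurable_superset_of_null hS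
  let fl : (M → ℝ) → M → ℤ := fun k x => ⌊k x / δ⌋
  have mfl : ∀ {k : M → ℝ}, Measurable k → Measurable (fl k) := fun hk =>
    Int.measurable_floor.comp (hk.div_const _)
  have hosc : ∀ (k : M → ℝ) (x y : M), fl k x = fl k y → |k x - k y| ≤ δ := by
    intro k x y hxy
    have := Int.abs_sub_lt_one_of_floor_eq_floor hxy
    rw [← sub_div, abs_div, abs_of_pos hδ', div_lt_one hδ'] at this
    exact this.le
  let T : ℤ × ℤ × ℤ → Set M := fun i => Nᶜ ∩ (fun x => (fl f x, fl g x, fl h x)) ⁻¹' {i}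
  have mT : ∀ i, MeasurableSet (T i) := fun i =>
    mN.compl.inter (((mfl mf).prodMk ((mfl mg).prodMk (mfl mh))) (measurableSet_singleton i))
  have hTS : ∀ i, T i ⊆ S := fun i x hx => by
    by_contra hxS
    exact hx.1 (hN hxS)
  have hTo : ∀ i, ∀ x ∈ T i, ∀ y ∈ T i,
      |f x - f y| ≤ δ ∧ |g x - g y| ≤ δ ∧ |h x - h y| ≤ δ := by
    intro i x hx y hy
    have := hx.2.trans hy.2.symm
    simp only [Prod.mk.injEq] at this
    exact ⟨hosc _ _ _ this.1, hosc _ _ _ this.2.1, hosc _ _ _ this.2.2⟩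
  have hcov : μ (⋃ i, T i)ᶜ = 0 := by
    refine measure_mono_null ?_ hN0
    intro x hx
    by_contra hxN
    exact hx (Set.mem_iUnion.2 ⟨(fl f x, fl g x, fl h x), hxN, rfl⟩)
  have hlt : ρ.dist A B < (d + δ : ℝ≥0) := by
    rw [hd']; exact_mod_cast lt_add_of_pos_right d hδ
  obtain ⟨i, A', hA', hlt⟩ := ρ.exists_piece mT hcov A B hlt
  rw [ρ.dist_comm] at hlt
  obtain ⟨j, B', hB', hlt⟩ := ρ.exists_piece mT hcov B A' hlt
  rw [ρ.dist_comm] at hlt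
  have hAsub : A'.1 ⊆ A.1 := hA' ▸ Set.inter_subset_left
  have hBsub : B'.1 ⊆ B.1 := hB' ▸ Set.inter_subset_left
  have hAT : A'.1 ⊆ T i := hA' ▸ Set.inter_subset_right
  have hBT : B'.1 ⊆ T j := hB' ▸ Set.inter_subset_right
  have hpos : 0 < ρ.dist A' B' := by
    refine h0.trans_le ((ρ.dist_anti_left hAsub B).trans ?_)
    rw [ρ.dist_comm, ρ.dist_comm A']
    exact ρ.dist_anti_left hBsub A'
  obtain ⟨x, hx⟩ := nonempty_of_measure_ne_zero A'.2.2
  obtain ⟨y, hy⟩ := nonempty_of_measure_ne_zero B'.2.2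
  -- variation of `f` and `g` between the two pieces
  have hvar : ∀ (k : M → ℝ) (l : ℝ≥0), Measurable k → ρ.lipNumber k = l →
      (∀ i, ∀ x ∈ T i, ∀ y ∈ T i, |k x - k y| ≤ δ) → |k x - k y| ≤ l * (d + δ) + 2 * δ := by
    intro k l mk hl hk
    have h1 : rangeDist μ k A' B' ≤ (l * (d + δ) : ℝ≥0) := by
      refine (ρ.rangeDist_le_mul hpos (hlt.trans ENNReal.coe_lt_top).ne).trans ?_
      rw [hl, ENNReal.coe_mul]
      gcongr
    have h2 : ENNReal.ofReal (|k x - k y| - 2 * δ) ≤ rangeDist μ k A' B' := by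
      refine le_iInf₂ fun a ha => le_iInf₂ fun b hb => ?_
      rw [edist_dist, Real.dist_eq]
      refine ENNReal.ofReal_le_ofReal ?_
      have ha' := abs_sub_le_of_mem_essRangeOn
        (fun x hx y hy => hk i x (hAT hx) y (hAT hy)) ha hx
      have hb' := abs_sub_le_of_mem_essRangeOn
        (fun x hx y hy => hk j x (hBT hx) y (hBT hy)) hb hy
      rw [abs_le] at ha' hb'
      have h3 := le_abs_self (a - b)
      have h4 := neg_abs_le (a - b)
      have : |k x - k y| ≤ |a - b| + 2 * δ := abs_le.2 ⟨by linarith, by linarith⟩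
      linarith
    have h3 := h2.trans h1
    rw [ENNReal.ofReal_le_coe] at h3
    push_cast at h3
    linarith
  have vf := hvar f lf mf hlf fun i x hx y hy => (hTo i x hx y hy).1
  have vg := hvar g lg mg hlg fun i x hx y hy => (hTo i x hx y hy).2.1
  obtain ⟨a, ha⟩ := essRangeOn_nonempty mh A'.2.2
  obtain ⟨b, hb⟩ := essRangeOn_nonempty mh B'.2.2
  have ha' := abs_sub_le_of_mem_essRangeOn
    (fun x hx y hy => (hTo i x (hAT hx) y (hAT hy)).2.2) ha hx
  have hb' := abs_sub_le_of_mem_essRangeOn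
    (fun x hx y hy => (hTo j x (hBT hx) y (hBT hy)).2.2) hb hy
  have hh := H x (hTS i (hAT hx)) y (hTS j (hBT hy))
  refine (iInf₂_le_of_le a (essRangeOn_mono hAsub ha)
    (iInf₂_le_of_le b (essRangeOn_mono hBsub hb) le_rfl)).trans ?_
  rw [edist_dist, Real.dist_eq, ENNReal.ofReal_le_coe]
  push_cast
  have hK := mul_le_mul_of_nonneg_left vf K.2
  have hL := mul_le_mul_of_nonneg_left vg L.2
  have hab : |a - b| ≤ |h x - h y| + 2 * δ := by
    rw [abs_le] at ha' hb'
    have h3 := le_abs_self (h x - h y)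
    have h4 := neg_abs_le (h x - h y)
    exact abs_le.2 ⟨by linarith, by linarith⟩
  have e1 : (K : ℝ) * (lf * (d + δ) + 2 * δ) + L * (lg * (d + δ) + 2 * δ) + 2 * δ =
      (K * lf + L * lg) * d + δ * (K * (lf + 2) + L * (lg + 2) + 2) := by ring
  simp only [NNReal.val_eq_coe] at hK hL
  linarith

theorem lipNumber_zero : ρ.lipNumber ((0 : LInfty μ) : M → ℝ) = 0 := by
  refine le_antisymm (iSup_le fun A => iSup_le fun B => iSup_le fun _ => ?_) bot_le
  have h0 : ∀ C : PosSet μ, (0 : ℝ) ∈ essRangeOn μ ((0 : LInfty μ) : M → ℝ) C.1 := by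
    intro C U hU h0
    apply C.2.2
    refine (measure_congr ?_).trans h0
    filter_upwards [LInfty.coe_zero (μ := μ)] with x hx
    refine propext ⟨fun h => ⟨h, ?_⟩, fun h => h.1⟩
    show (0 : LInfty μ) x ∈ U
    rw [hx]; exact mem_of_mem_nhds hU
  have : rangeDist μ ((0 : LInfty μ) : M → ℝ) A B = 0 := by
    refine le_antisymm ?_ bot_le
    exact (iInf₂_le_of_le 0 (h0 A) (iInf₂_le_of_le 0 (h0 B) (by simp)))
  simp [this]

theorem lipNumber_add_le {f g : LInfty μ} (hf : ρ.lipNumber f ≠ ∞) (hg : ρ.lipNumber g ≠ ∞) :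
    ρ.lipNumber (f + g : LInfty μ) ≤ ρ.lipNumber f + ρ.lipNumber g := by
  have := ρ.lipNumber_le_of_abs_sub_le (K := 1) (L := 1) f.measurable_coe g.measurable_coe
    (f + g).measurable_coe (LInfty.coe_add f g) (fun x hx y hy => ?_) hf hg
  · simpa using this
  · have hx' : (f + g) x = f x + g x := hx
    have hy' : (f + g) y = f y + g y := hy
    rw [hx', hy', NNReal.coe_one, one_mul, one_mul]
    calc |f x + g x - (f y + g y)| = |(f x - f y) + (g x - g y)| := by ring_nf
      _ ≤ _ := abs_add_le _ _

theorem lipNumber_smul_le (c : ℝ) {f : LInfty μ} (hf : ρ.lipNumber f ≠ ∞) :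
    ρ.lipNumber (c • f : LInfty μ) ≤ ‖c‖₊ * ρ.lipNumber f := by
  have := ρ.lipNumber_le_of_abs_sub_le (K := ‖c‖₊) (L := 0) f.measurable_coe f.measurable_coe
    (c • f).measurable_coe (LInfty.coe_smul c f) (fun x hx y hy => ?_) hf hf
  · simpa using this
  · have hx' : (c • f) x = c * f x := hx
    have hy' : (c • f) y = c * f y := hy
    rw [hx', hy', ← mul_sub, abs_mul]
    simp

theorem lipNumber_mul_le {f g : LInfty μ} (hf : ρ.lipNumber f ≠ ∞) (hg : ρ.lipNumber g ≠ ∞) :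
    ρ.lipNumber (f * g : LInfty μ) ≤ ‖g‖₊ * ρ.lipNumber f + ‖f‖₊ * ρ.lipNumber g := by
  refine ρ.lipNumber_le_of_abs_sub_le
    (S := {x | (f * g) x = f x * g x ∧ |f x| ≤ ‖f‖ ∧ |g x| ≤ ‖g‖}) f.measurable_coe
    g.measurable_coe (f * g).measurable_coe ?_ (fun x hx y hy => ?_) hf hg
  · filter_upwards [LInfty.coe_mul f g, LInfty.ae_abs_le f, LInfty.ae_abs_le g] with x h1 h2 h3
    exact ⟨h1, h2, h3⟩
  · rw [hx.1, hy.1]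
    calc |f x * g x - f y * g y| = |g x * (f x - f y) + f y * (g x - g y)| := by ring_nf
      _ ≤ |g x| * |f x - f y| + |f y| * |g x - g y| := by
        rw [← abs_mul, ← abs_mul]; exact abs_add_le _ _
      _ ≤ _ := by
        refine add_le_add (mul_le_mul_of_nonneg_right ?_ (abs_nonneg _))
          (mul_le_mul_of_nonneg_right ?_ (abs_nonneg _))
        · simpa using hx.2.2
        · simpa using hy.2.1

theorem lipNumber_algebraMap (c : ℝ) :
    ρ.lipNumber (algebraMap ℝ (LInfty μ) c : LInfty μ) = 0 := by
  have h0 : ρ.lipNumber ((0 : LInfty μ) : M → ℝ) ≠ ∞ := by simp [lipNumber_zero]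
  have hone := ρ.lipNumber_le_of_abs_sub_le (K := 0) (L := 0) (0 : LInfty μ).measurable_coe
    (0 : LInfty μ).measurable_coe (algebraMap ℝ (LInfty μ) c).measurable_coe
    (S := {x | (algebraMap ℝ (LInfty μ) c) x = c}) ?_ (fun x hx y hy => ?_) h0 h0
  · simpa using hone
  · rw [Algebra.algebraMap_eq_smul_one]
    filter_upwards [LInfty.coe_smul c (1 : LInfty μ), LInfty.coe_one (μ := μ)] with x h1 h2
    show (c • (1 : LInfty μ)) x = c
    rw [h1, h2, mul_one]
  · rw [hx, hy]; simp

/-- The bounded Lipschitz functions, as a subalgebra of `L^∞`. -/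
def lipSubalgebra : Subalgebra ℝ (LInfty μ) where
  carrier := {f | ρ.lipNumber f < ∞}
  add_mem' := fun hf hg =>
    (ρ.lipNumber_add_le (ne_of_lt hf) (ne_of_lt hg)).trans_lt (ENNReal.add_lt_top.2 ⟨hf, hg⟩)
  mul_mem' := fun hf hg =>
    (ρ.lipNumber_mul_le (ne_of_lt hf) (ne_of_lt hg)).trans_lt
      (ENNReal.add_lt_top.2 ⟨ENNReal.mul_lt_top ENNReal.coe_lt_top hf,
        ENNReal.mul_lt_top ENNReal.coe_lt_top hg⟩)
  algebraMap_mem' := fun c => by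
    simp only [Set.mem_ofPred_eq, lipNumber_algebraMap]; exact ENNReal.zero_lt_top

/-- A measurable metric: the bounded Lipschitz functions are weak*-dense in `L^∞`. -/
def IsMetric : Prop :=
  @Dense (LInfty μ) (weakStar (linftyPredual μ)) (ρ.lipSubalgebra : Set (LInfty μ))

/-- The space `Lip(M)`, to be normed by `max (L(f), ‖f‖_∞)`. -/
def Lip : Type u := ρ.lipSubalgebra

namespace Lip

variable {ρ}

noncomputable instance : CommRing ρ.Lip := inferInstanceAs (CommRing ρ.lipSubalgebra)

noncomputable instance instAlgebra : Algebra ℝ ρ.Lip := inferInstanceAs (Algebra ℝ ρ.lipSubalgebra)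

/-- The inclusion of `Lip(M)` in `L^∞(M)`. -/
def toLInfty (f : ρ.Lip) : LInfty μ := Subtype.val (p := fun g => g ∈ ρ.lipSubalgebra) f

theorem lipNumber_ne_top (f : ρ.Lip) : ρ.lipNumber f.toLInfty ≠ ∞ :=
  ne_of_lt (Subtype.property (p := fun g => g ∈ ρ.lipSubalgebra) f)

/-- The norm `‖f‖_L = max (L(f), ‖f‖_∞)`. -/
noncomputable instance : Norm ρ.Lip := ⟨fun f => max (ρ.lipNumber f.toLInfty).toReal ‖f.toLInfty‖⟩

theorem norm_def (f : ρ.Lip) : ‖f‖ = max (ρ.lipNumber f.toLInfty).toReal ‖f.toLInfty‖ := rfl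

theorem norm_smul_le' (c : ℝ) (f : ρ.Lip) : ‖c • f‖ ≤ ‖c‖ * ‖f‖ := by
  have h1 := ENNReal.toReal_mono (ENNReal.mul_ne_top ENNReal.coe_ne_top f.lipNumber_ne_top)
    (ρ.lipNumber_smul_le c f.lipNumber_ne_top)
  rw [ENNReal.toReal_mul] at h1
  refine max_le (h1.trans ?_) ((_root_.norm_smul_le c f.toLInfty).trans ?_)
  · exact mul_le_mul_of_nonneg_left (le_max_left _ _) (norm_nonneg c)
  · exact mul_le_mul_of_nonneg_left (le_max_right _ _) (norm_nonneg c)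

noncomputable instance : NormedAddCommGroup ρ.Lip :=
  AddGroupNorm.toNormedAddCommGroup
    { toFun := fun f => ‖f‖
      map_zero' := by
        show max (ρ.lipNumber ((0 : LInfty μ) : M → ℝ)).toReal ‖(0 : LInfty μ)‖ = 0
        simp [lipNumber_zero]
      add_le' := fun f g => by
        have h1 := ENNReal.toReal_mono
          (ENNReal.add_ne_top.2 ⟨f.lipNumber_ne_top, g.lipNumber_ne_top⟩)
          (ρ.lipNumber_add_le f.lipNumber_ne_top g.lipNumber_ne_top)
        rw [ENNReal.toReal_add f.lipNumber_ne_top g.lipNumber_ne_top] at h1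
        refine max_le (h1.trans ?_) ((norm_add_le f.toLInfty g.toLInfty).trans ?_)
        · exact add_le_add (le_max_left _ _) (le_max_left _ _)
        · exact add_le_add (le_max_right _ _) (le_max_right _ _)
      neg' := fun f => by
        have h : ∀ g : ρ.Lip, ‖-g‖ ≤ ‖g‖ := fun g => by
          have := norm_smul_le' (-1 : ℝ) g
          simpa using this
        exact le_antisymm (h f) (by simpa using h (-f))
      eq_zero_of_map_eq_zero' := fun f hf => by
        have h1 : ‖f.toLInfty‖ ≤ 0 := (le_max_right _ _).trans (le_of_eq hf)
        exact Subtype.ext (norm_le_zero_iff.1 h1) }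

noncomputable instance : NormedSpace ℝ ρ.Lip where
  norm_smul_le := norm_smul_le'

/-- The predual of `Lip(M)`: the bounded linear functionals whose restriction to the closed unit
ball is continuous for the weak* topology of `L^∞`. The resulting topology `weakStar (lipPredual ρ)`
is the weak* topology of `Lip(M)` as a dual space. -/
def predual (ρ : MeasurablePseudometric μ) : Submodule ℝ (StrongDual ℝ ρ.Lip) where
  carrier := {p | @ContinuousOn ρ.Lip ℝ
    (TopologicalSpace.induced toLInfty (weakStar (linftyPredual μ))) _ p (Metric.closedBall 0 1)}
  zero_mem' := @continuousOn_const _ _ (_) _ _ _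
  add_mem' := fun {p q} hp hq => @ContinuousOn.add _ _ _ _ _ (_) p q _ hp hq
  smul_mem' := fun c p hp => @ContinuousOn.const_smul _ _ _ _ _ _ (_) p _ hp c

end Lip

/-- A metric derivation `δ : Lip(M) → E`, where the weak* topology of `E` comes from `P`:
a bounded linear map which is weak*-continuous and satisfies `δ(fg) = f δ(g) + g δ(f)`. -/
structure IsMetricDerivation {E : Type v} [NormedAddCommGroup E] [NormedSpace ℝ E]
    [Module (LInfty μ) E] (P : Submodule ℝ (StrongDual ℝ E)) (δ : ρ.Lip →L[ℝ] E) : Prop where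
  continuous : Continuous[weakStar (Lip.predual ρ), weakStar P] δ
  leibniz : ∀ f g : ρ.Lip, δ (f * g) = f.toLInfty • δ g + g.toLInfty • δ f

/-- The metric derivations from `Lip(M)` into `L^∞(M)`, as a submodule of the bounded maps. -/
def vectorFieldSubmodule : Submodule (LInfty μ) (ρ.Lip →L[ℝ] LInfty μ) where
  carrier := {δ | ρ.IsMetricDerivation (linftyPredual μ) δ}
  zero_mem' := ⟨continuous_weakStar_iff.2 fun p _ => by
    simpa using @continuous_const _ _ (_) _ _, fun f g => by simp⟩
  add_mem' := fun {δ ε} hδ hε =>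
    ⟨continuous_weakStar_iff.2 fun p hp => by
      have h := @Continuous.add _ _ _ _ _ (_) _ _
        (continuous_weakStar_iff.1 hδ.continuous p hp) (continuous_weakStar_iff.1 hε.continuous p hp)
      convert h using 1
      ext x
      simp,
    fun f g => by
      simp only [add_apply, hδ.leibniz, hε.leibniz, smul_add]; abel⟩
  smul_mem' := fun h δ hδ =>
    ⟨continuous_weakStar_iff.2 fun p hp => by
      obtain ⟨q, hq, hqp⟩ := exists_linftyPredual_mul h hp
      simpa [hqp] using continuous_weakStar_iff.1 hδ.continuous q hq,
    fun f g => by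
      simp only [smul_apply, hδ.leibniz, smul_eq_mul]; ring⟩

/-- The module `X(M)` of measurable vector fields: the metric derivations from `Lip(M)` into
`L^∞(M)`, with the operator norm and the action `(h δ)(f) = h δ(f)`. -/
def VectorFields : Type u := ρ.vectorFieldSubmodule

namespace VectorFields

variable {ρ}

noncomputable instance : NormedAddCommGroup ρ.VectorFields :=
  inferInstanceAs (NormedAddCommGroup ρ.vectorFieldSubmodule)

noncomputable instance : NormedSpace ℝ ρ.VectorFields :=
  inferInstanceAs (NormedSpace ℝ ρ.vectorFieldSubmodule)

noncomputable instance : Module (LInfty μ) ρ.VectorFields :=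
  inferInstanceAs (Module (LInfty μ) ρ.vectorFieldSubmodule)

/-- The underlying bounded linear map of a vector field. -/
def toCLM (φ : ρ.VectorFields) : ρ.Lip →L[ℝ] LInfty μ :=
  Subtype.val (p := fun δ => δ ∈ ρ.vectorFieldSubmodule) φ

end VectorFields

/-- The module `Ω(M)` of measurable 1-forms: the dual module of `X(M)`. -/
abbrev OneForms : Type u := DualModule μ ρ.VectorFields

/-- The predual of `Ω(M)` as a dual module, which defines its weak* topology. -/
noncomputable abbrev oneFormsPredual : Submodule ℝ (StrongDual ℝ ρ.OneForms) :=
  DualModule.predual μ ρ.VectorFields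

/-- The exterior derivative of `f`: the 1-form `φ ↦ φ(f)`. -/
noncomputable def extDerivFun (f : ρ.Lip) : ρ.OneForms :=
  ⟨LinearMap.mkContinuous
    { toFun := fun φ : ρ.VectorFields => φ.toCLM f
      map_add' := fun _ _ => rfl
      map_smul' := fun _ _ => rfl } ‖f‖
    (fun φ => by rw [mul_comm]; exact φ.toCLM.le_opNorm f), fun _ _ => rfl⟩

/-- The exterior derivative `d : Lip(M) → Ω(M)`, `(df)(φ) = φ(f)`. -/
noncomputable def extDeriv : ρ.Lip →L[ℝ] ρ.OneForms :=
  LinearMap.mkContinuous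
    { toFun := ρ.extDerivFun
      map_add' := fun f g => Subtype.ext (ContinuousLinearMap.ext fun φ => map_add φ.toCLM f g)
      map_smul' := fun c f => Subtype.ext (ContinuousLinearMap.ext fun φ => map_smul φ.toCLM c f) }
    1 (fun f => by
      rw [one_mul]
      exact ContinuousLinearMap.opNorm_le_bound _ (norm_nonneg f) fun φ => by
        rw [mul_comm]; exact φ.toCLM.le_opNorm f)

end MeasurablePseudometric

end Metric

end MeasMetric

open MeasMetric

/-!
The 1-forms are the dual of the module `X(M)` of vector fields, and every abelian W*-module `E` is
the dual of its module `N` of weak*-continuous homomorphisms `E → L^∞`. A metric derivation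
`δ : Lip(M) → E` induces a map `N → X(M)`, `Φ ↦ Φ ∘ δ`
(`IsMetricDerivation.pullback`), and its transpose `Ω(M) = X(M)' → N' = E` is the map `T`
(`IsMetricDerivation.exists_factor`). By construction `Φ(T(df)) = (df)(Φ ∘ δ) = Φ(δ f)`, so that
`T ∘ d = δ`; the norm of `T` is that of `δ` because `d` is contractive.

That a dual module is an abelian W*-module (`DualModule.isAbelianWStarModule`) rests on the
duality of `L^1` and `L^∞` for σ-finite measures (`exists_linfty_of_dual_l1`), which is derived here
from the self-duality of `L^2`.

That `E` is the dual of `N` (`IsAbelianWStarModule.exists_eq_apply_of_bounded`) rests on a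
factorization of the functionals `p` of the predual
(`IsAbelianWStarModule.exists_factorization`). Each `φ ∈ E` has a density `k_φ ∈ L^1` with
`p (f φ) = ∫ f k_φ dμ`. If `p` attains its norm on the unit ball at `φ₀`, then pasting `φ` and `φ₀`
along projections shows `|k_φ| ≤ ‖φ‖ k_{φ₀}`, and `Φ(φ) = k_φ / k_{φ₀}` is a member of `N` with
`p (φ) = ∫ Φ(φ) k_{φ₀} dμ`. A bounded module map `L : N → L^∞` then defines the functional
`p ↦ ∫ L(Φ) k_{φ₀} dμ` on the predual of `E`, which is independent of the choice of the
factorization (`normalDual.sum_integral_map_eq_zero`) and hence linear, and so comes from an element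
of `E`.
-/

namespace MeasMetric

universe u v w

/-! ### Duality of `L^1` and `L^∞` -/

section Duality

variable {M : Type u} [MeasurableSpace M] {μ : Measure M}

namespace LInfty

theorem exists_coe_ae_eq {f : M → ℝ} (hf : AEStronglyMeasurable f μ) {C : ℝ}
    (h : ∀ᵐ x ∂μ, |f x| ≤ C) : ∃ F : LInfty μ, (F : M → ℝ) =ᵐ[μ] f :=
  ⟨(memLp_top_of_bound hf C h).toLp f, MemLp.coeFn_toLp (memLp_top_of_bound hf C h)⟩

theorem exists_indicator {A : Set M} (hA : MeasurableSet A) :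
    ∃ e : LInfty μ, (e : M → ℝ) =ᵐ[μ] A.indicator 1 ∧ e * e = e := by
  obtain ⟨e, he⟩ := exists_coe_ae_eq (μ := μ) (f := A.indicator 1) (C := 1)
    (stronglyMeasurable_one.indicator hA).aestronglyMeasurable
    (.of_forall fun x => by by_cases hx : x ∈ A <;> simp [hx])
  refine ⟨e, he, ext ?_⟩
  filter_upwards [coe_mul e e, he] with x h1 h2
  rw [h1, h2]
  by_cases hx : x ∈ A <;> simp [hx]

theorem integrable_mul_of_integrable (f : LInfty μ) {k : M → ℝ} (hk : Integrable k μ) :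
    Integrable (fun x => f x * k x) μ :=
  hk.bdd_mul (c := ‖f‖) f.measurable_coe.aestronglyMeasurable (ae_abs_le f)

theorem abs_integral_mul_le (f : LInfty μ) {k : M → ℝ} (hk : Integrable k μ) :
    |∫ x, f x * k x ∂μ| ≤ ‖f‖ * ∫ x, |k x| ∂μ := by
  rw [← integral_const_mul, ← Real.norm_eq_abs]
  refine norm_integral_le_of_norm_le (hk.abs.const_mul _) ?_
  filter_upwards [ae_abs_le f] with x hx
  rw [Real.norm_eq_abs, abs_mul]
  exact mul_le_mul_of_nonneg_right hx (abs_nonneg _)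

theorem abs_integral_mul_le_norm (f : LInfty μ) (g : Lp ℝ 1 μ) :
    |∫ x, f x * g x ∂μ| ≤ ‖f‖ * ‖g‖ := by
  rw [L1.norm_eq_integral_norm]
  exact abs_integral_mul_le f (L1.integrable_coeFn g)

theorem integral_indicator_mul {e : LInfty μ} {A : Set M} (hA : MeasurableSet A)
    (he : (e : M → ℝ) =ᵐ[μ] A.indicator 1) (k : M → ℝ) :
    ∫ x, e x * k x ∂μ = ∫ x in A, k x ∂μ := by
  rw [← integral_indicator hA]
  refine integral_congr_ae ?_
  filter_upwards [he] with x hx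
  rw [hx]
  by_cases h : x ∈ A <;> simp [h]

theorem ae_le_of_forall_integral_indicator_le {k l : M → ℝ} (hk : Integrable k μ)
    (hl : Integrable l μ)
    (h : ∀ A : Set M, MeasurableSet A → ∀ e : LInfty μ, (e : M → ℝ) =ᵐ[μ] A.indicator 1 →
      e * e = e → ∫ x, e x * k x ∂μ ≤ ∫ x, e x * l x ∂μ) : k ≤ᵐ[μ] l := by
  refine ae_le_of_forall_setIntegral_le hk hl fun A hA _ => ?_
  obtain ⟨e, he, hee⟩ := exists_indicator (μ := μ) hA
  rw [← integral_indicator_mul hA he, ← integral_indicator_mul hA he]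
  exact h A hA e he hee

theorem ae_eq_of_forall_integral_mul_eq {k l : M → ℝ} (hk : Integrable k μ)
    (hl : Integrable l μ) (h : ∀ f : LInfty μ, ∫ x, f x * k x ∂μ = ∫ x, f x * l x ∂μ) :
    k =ᵐ[μ] l :=
  (ae_le_of_forall_integral_indicator_le hk hl fun _ _ e _ _ => (h e).le).antisymm
    (ae_le_of_forall_integral_indicator_le hl hk fun _ _ e _ _ => (h e).ge)

theorem exists_sign {k : M → ℝ} (hk : AEStronglyMeasurable k μ) :
    ∃ s : LInfty μ, ‖s‖ ≤ 1 ∧ ∀ᵐ x ∂μ, s x * k x = |k x| := by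
  have hm : Measurable fun t : ℝ => if 0 ≤ t then (1 : ℝ) else -1 :=
    Measurable.ite measurableSet_Ici measurable_const measurable_const
  have hb : ∀ t : ℝ, |if 0 ≤ t then (1 : ℝ) else -1| ≤ 1 := fun t => by split_ifs <;> simp
  obtain ⟨s, hs⟩ := exists_coe_ae_eq (μ := μ) (f := fun x => if 0 ≤ k x then (1 : ℝ) else -1)
    (C := 1) (hm.comp_aemeasurable hk.aemeasurable).aestronglyMeasurable
    (.of_forall fun x => hb _)
  refine ⟨s, norm_le_of_ae zero_le_one ?_, ?_⟩
  · filter_upwards [hs] with x hx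
    rw [hx]; exact hb _
  · filter_upwards [hs] with x hx
    rw [hx]
    split_ifs with h
    · rw [one_mul, abs_of_nonneg h]
    · rw [abs_of_neg (not_le.1 h)]; ring

/-- If `k` vanishes where `h` does, then `k` is approximated in `L^1` by bounded multiples
of `h`. -/
theorem exists_mul_approx {h k : M → ℝ} (hh : Integrable h μ) (hk : Integrable k μ)
    (h0 : ∀ᵐ x ∂μ, h x = 0 → k x = 0) {ε : ℝ} (hε : 0 < ε) :
    ∃ u : LInfty μ, ∫ x, |k x - u x * h x| ∂μ < ε := by
  -- truncate the quotient `k / h` at height `n`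
  let q : ℕ → M → ℝ := fun n x => max (-(n : ℝ)) (min (k x / h x) n)
  have hq : ∀ n x, |q n x| ≤ n := fun n x =>
    abs_le.2 ⟨le_max_left _ _, max_le (by linarith [(Nat.cast_nonneg n : (0 : ℝ) ≤ n)])
      (min_le_right _ _)⟩
  have hqk : ∀ n x, |q n x| ≤ |k x / h x| := fun n x => by
    have hn : (0 : ℝ) ≤ n := Nat.cast_nonneg n
    refine abs_le.2 ⟨?_, max_le ?_ ((min_le_left _ _).trans (le_abs_self _))⟩
    · refine le_max_of_le_right (le_min (neg_abs_le _) ?_)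
      linarith [abs_nonneg (k x / h x)]
    · linarith [abs_nonneg (k x / h x)]
  have hqm : ∀ n, AEStronglyMeasurable (q n) μ := fun n =>
    (aemeasurable_const.max ((hk.aemeasurable.div hh.aemeasurable).min
      aemeasurable_const)).aestronglyMeasurable
  have hlim : Filter.Tendsto (fun n => ∫ x, |k x - q n x * h x| ∂μ) Filter.atTop (𝓝 0) := by
    have := tendsto_integral_of_dominated_convergence (μ := μ)
      (F := fun n x => |k x - q n x * h x|) (f := fun _ => (0 : ℝ)) (fun x => 2 * |k x|)
      (fun n => ((hk.aestronglyMeasurable.sub ((hqm n).mul hh.aestronglyMeasurable)).norm))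
      (hk.abs.const_mul 2)
      (fun n => by
        filter_upwards [h0] with x hx
        have h1 : |q n x * h x| ≤ |k x| := by
          rw [abs_mul]
          refine (mul_le_mul_of_nonneg_right (hqk n x) (abs_nonneg _)).trans ?_
          by_cases hz : h x = 0
          · simp [hz]
          · rw [← abs_mul, div_mul_cancel₀ _ hz]
        rw [Real.norm_eq_abs, abs_abs]
        linarith [abs_sub (k x) (q n x * h x)])
      (by
        filter_upwards [h0] with x hx
        refine tendsto_const_nhds.congr' ?_
        obtain ⟨N, hN⟩ := exists_nat_ge |k x / h x|
        filter_upwards [Filter.eventually_ge_atTop N] with n hn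
        have hn' : |k x / h x| ≤ n := hN.trans (by exact_mod_cast hn)
        have : q n x = k x / h x := by
          show max (-(n : ℝ)) (min (k x / h x) n) = _
          rw [min_eq_left (abs_le.1 hn').2, max_eq_right (abs_le.1 hn').1]
        rw [this]
        by_cases hz : h x = 0
        · simp [hz, hx hz]
        · rw [div_mul_cancel₀ _ hz, sub_self, abs_zero])
    simpa using this
  obtain ⟨n, hn⟩ := (hlim.eventually (gt_mem_nhds hε)).exists
  obtain ⟨u, hu⟩ := exists_coe_ae_eq (μ := μ) (hqm n) (.of_forall (hq n))
  refine ⟨u, lt_of_eq_of_lt (integral_congr_ae ?_) hn⟩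
  filter_upwards [hu] with x hx
  rw [hx]

theorem exists_pos_integrable (μ : Measure M) [SigmaFinite μ] :
    ∃ w : M → ℝ, Integrable w μ ∧ Measurable w ∧ ∀ x, 0 < w x := by
  obtain ⟨g, hg, hm, hi⟩ := exists_pos_lintegral_lt_of_sigmaFinite μ one_ne_zero
  refine ⟨fun x => g x, ⟨hm.coe_nnreal_real.aestronglyMeasurable, ?_⟩, hm.coe_nnreal_real,
    fun x => NNReal.coe_pos.2 (hg x)⟩
  refine lt_of_le_of_lt (le_of_eq ?_) (hi.trans ENNReal.one_lt_top)
  exact lintegral_congr fun x => by simp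

theorem norm_le_of_forall_abs_integral_mul_le [SigmaFinite μ] {f : LInfty μ} {C : ℝ} (hC : 0 ≤ C)
    (h : ∀ g : Lp ℝ 1 μ, |∫ x, f x * g x ∂μ| ≤ C * ‖g‖) : ‖f‖ ≤ C := by
  obtain ⟨w, hw, mw, hpos⟩ := exists_pos_integrable μ
  obtain ⟨s, hs1, hs⟩ := exists_sign (μ := μ) f.measurable_coe.aestronglyMeasurable
  have key : (fun x => |f x| * w x) ≤ᵐ[μ] fun x => C * w x := by
    refine ae_le_of_forall_integral_indicator_le
      (by simpa using ((integrable_mul_of_integrable f hw).abs.congr (.of_forall fun x => by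
        simp only [abs_mul, abs_of_pos (hpos x)]))) (hw.const_mul C) fun A hA e he _ => ?_
    have hi : Integrable (fun x => e x * (s x * w x)) μ :=
      integrable_mul_of_integrable e (integrable_mul_of_integrable s hw)
    have h1 := (le_abs_self _).trans (h (hi.toL1 _))
    have e1 : ∫ x, f x * (hi.toL1 _) x ∂μ = ∫ x, e x * (|f x| * w x) ∂μ := by
      refine integral_congr_ae ?_
      filter_upwards [hi.coeFn_toL1, hs] with x hx hx'
      rw [hx, ← hx']; ring
    rw [e1] at h1
    refine h1.trans ?_
    have e2 : ∫ x, e x * (C * w x) ∂μ = C * ∫ x, e x * w x ∂μ := by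
      rw [← integral_const_mul]
      exact integral_congr_ae (.of_forall fun x => by ring)
    rw [e2, L1.norm_eq_integral_norm]
    refine mul_le_mul_of_nonneg_left (integral_mono_ae (L1.integrable_coeFn _).norm
      (integrable_mul_of_integrable e hw) ?_) hC
    filter_upwards [hi.coeFn_toL1, he, ae_abs_le s] with x hx hx' hx''
    have hs' : |s x| ≤ 1 := hx''.trans hs1
    show ‖_‖ ≤ _
    rw [hx, hx']
    by_cases hxA : x ∈ A
    · simp only [hxA, Set.indicator_of_mem, Pi.one_apply, one_mul, Real.norm_eq_abs, abs_mul,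
        abs_of_pos (hpos x)]
      exact mul_le_of_le_one_left (hpos x).le hs'
    · simp [hxA]
  refine norm_le_of_ae hC ?_
  filter_upwards [key] with x hx
  exact le_of_mul_le_mul_right hx (hpos x)

theorem eq_of_forall_integral_mul_eq [SigmaFinite μ] {f g : LInfty μ}
    (h : ∀ k : Lp ℝ 1 μ, ∫ x, f x * k x ∂μ = ∫ x, g x * k x ∂μ) : f = g := by
  rw [← sub_eq_zero, ← norm_le_zero_iff]
  refine norm_le_of_forall_abs_integral_mul_le le_rfl fun k => ?_
  have : ∫ x, (f - g) x * k x ∂μ = 0 := by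
    rw [← sub_eq_zero.2 (h k), ← integral_sub (integrable_mul f k) (integrable_mul g k)]
    refine integral_congr_ae ?_
    filter_upwards [coe_add (f - g) g] with x hx
    rw [sub_add_cancel] at hx
    rw [hx]; ring
  rw [this]; simp

end LInfty

open LInfty

theorem mem_linftyPredual_iff {p : StrongDual ℝ (LInfty μ)} : p ∈ linftyPredual μ ↔
    ∃ k : M → ℝ, Integrable k μ ∧ ∀ f : LInfty μ, p f = ∫ x, f x * k x ∂μ := by
  constructor
  · rintro ⟨g, hg⟩
    exact ⟨g, L1.integrable_coeFn g, hg⟩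
  · rintro ⟨k, hk, h⟩
    refine ⟨hk.toL1 k, fun f => (h f).trans (integral_congr_ae ?_)⟩
    filter_upwards [hk.coeFn_toL1] with x hx
    rw [hx]

/-- The canonical embedding of `L^1` in the dual of `L^∞`. -/
noncomputable def l1ToDual (μ : Measure M) : Lp ℝ 1 μ →ₗ[ℝ] StrongDual ℝ (LInfty μ) where
  toFun g := LinearMap.mkContinuous
    { toFun := fun f => ∫ x, f x * g x ∂μ
      map_add' := fun f f' => by
        rw [← integral_add (integrable_mul f g) (integrable_mul f' g)]
        refine integral_congr_ae ?_
        filter_upwards [coe_add f f'] with x hx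
        rw [hx]; ring
      map_smul' := fun c f => by
        rw [RingHom.id_apply, smul_eq_mul, ← integral_const_mul]
        refine integral_congr_ae ?_
        filter_upwards [coe_smul c f] with x hx
        rw [hx]; ring } ‖g‖ (fun f =>
      (abs_integral_mul_le_norm f g).trans_eq (mul_comm _ _))
  map_add' g g' := ContinuousLinearMap.ext fun f => by
    show ∫ x, f x * (g + g') x ∂μ = ∫ x, f x * g x ∂μ + ∫ x, f x * g' x ∂μ
    rw [← integral_add (integrable_mul f g) (integrable_mul f g')]
    refine integral_congr_ae ?_
    filter_upwards [Lp.coeFn_add g g'] with x hx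
    rw [hx, Pi.add_apply]; ring
  map_smul' c g := ContinuousLinearMap.ext fun f => by
    show ∫ x, f x * (c • g) x ∂μ = c * ∫ x, f x * g x ∂μ
    rw [← integral_const_mul]
    refine integral_congr_ae ?_
    filter_upwards [Lp.coeFn_smul c g] with x hx
    rw [hx, Pi.smul_apply, smul_eq_mul]; ring

theorem l1ToDual_apply (g : Lp ℝ 1 μ) (f : LInfty μ) :
    l1ToDual μ g f = ∫ x, f x * g x ∂μ := rfl

theorem norm_l1ToDual (g : Lp ℝ 1 μ) : ‖l1ToDual μ g‖ = ‖g‖ := by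
  refine le_antisymm (ContinuousLinearMap.opNorm_le_bound _ (norm_nonneg g) fun f => by
    rw [mul_comm]
    exact abs_integral_mul_le_norm f g) ?_
  obtain ⟨s, hs1, hs⟩ := exists_sign (L1.integrable_coeFn g).aestronglyMeasurable
  have h1 : l1ToDual μ g s = ‖g‖ := by
    rw [l1ToDual_apply, L1.norm_eq_integral_norm]
    exact integral_congr_ae hs
  calc ‖g‖ = l1ToDual μ g s := h1.symm
    _ ≤ ‖l1ToDual μ g s‖ := le_abs_self _
    _ ≤ ‖l1ToDual μ g‖ * ‖s‖ := (l1ToDual μ g).le_opNorm s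
    _ ≤ ‖l1ToDual μ g‖ := mul_le_of_le_one_right (norm_nonneg _) hs1

theorem l1ToDual_mem (g : Lp ℝ 1 μ) : l1ToDual μ g ∈ linftyPredual μ := ⟨g, fun _ => rfl⟩

theorem exists_l1ToDual_eq {p : StrongDual ℝ (LInfty μ)} (hp : p ∈ linftyPredual μ) :
    ∃ g, l1ToDual μ g = p :=
  hp.imp fun _ hg => ContinuousLinearMap.ext fun f => (hg f).symm

theorem isClosed_linftyPredual : IsClosed (linftyPredual μ : Set (StrongDual ℝ (LInfty μ))) := by
  let J : Lp ℝ 1 μ →ₗᵢ[ℝ] StrongDual ℝ (LInfty μ) := ⟨l1ToDual μ, norm_l1ToDual⟩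
  have : (linftyPredual μ : Set (StrongDual ℝ (LInfty μ))) = Set.range J :=
    Set.ext fun p => ⟨exists_l1ToDual_eq, by rintro ⟨g, rfl⟩; exact l1ToDual_mem g⟩
  rw [this]
  exact J.isometry.isClosedEmbedding.isClosed_range

/-- The dual of `L^1` is `L^∞`. With `s` a positive element of `L^2`, the functional
`u ↦ ξ (u s)` on `L^2` is represented by some `v` in `L^2`, and the quotient `v / s` represents
`ξ`. -/
theorem exists_linfty_of_dual_l1 [SigmaFinite μ] (ξ : StrongDual ℝ (Lp ℝ 1 μ)) :
    ∃ f : LInfty μ, ∀ g : Lp ℝ 1 μ, ξ g = ∫ x, f x * g x ∂μ := by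
  obtain ⟨w, hw, mw, hpos⟩ := exists_pos_integrable μ
  have hss : ∀ x, √(w x) * √(w x) = w x := fun x => Real.mul_self_sqrt (hpos x).le
  have hspos : ∀ x, 0 < √(w x) := fun x => Real.sqrt_pos.2 (hpos x)
  have hs2 : MemLp (fun x => √(w x)) 2 μ :=
    (memLp_two_iff_integrable_sq mw.sqrt.aestronglyMeasurable).2 (by
      simpa only [sq, hss] using hw)
  let s : Lp ℝ 2 μ := hs2.toLp _
  have hs : (s : M → ℝ) =ᵐ[μ] fun x => √(w x) := hs2.coeFn_toLp
  let H : Lp ℝ 2 μ →L[ℝ] Lp ℝ 1 μ := ((ContinuousLinearMap.mul ℝ ℝ).holderL μ 2 2 1).flip s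
  have hH : ∀ u : Lp ℝ 2 μ, (H u : M → ℝ) =ᵐ[μ] fun x => u x * s x := fun u =>
    (ContinuousLinearMap.mul ℝ ℝ).coeFn_holder (r := 1) u s
  obtain ⟨v, hv⟩ : ∃ v : Lp ℝ 2 μ, ∀ u : Lp ℝ 2 μ, ξ (H u) = ∫ x, u x * v x ∂μ := by
    refine ⟨(InnerProductSpace.toDual ℝ (Lp ℝ 2 μ)).symm (ξ.comp H), fun u => ?_⟩
    rw [← ContinuousLinearMap.comp_apply, ← InnerProductSpace.toDual_symm_apply, L2.inner_def]
    exact integral_congr_ae (.of_forall fun x => by simp)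
  have hvi : Integrable (fun x => v x * s x) μ := (Lp.memLp v).integrable_mul (Lp.memLp s)
  -- `v * s` represents `ξ` on the bounded multiples of `w = s * s`
  have hξ : ∀ (u : LInfty μ) (g : Lp ℝ 1 μ), (g : M → ℝ) =ᵐ[μ] (fun x => u x * w x) →
      ξ g = ∫ x, u x * (v x * s x) ∂μ := by
    intro u g hg
    have hm : MemLp (fun x => u x * s x) 2 μ := MemLp.mul (p := ∞) (q := 2) (Lp.memLp s) (memLp u)
    have hgH : g = H (hm.toLp _) := by
      refine Lp.ext ?_
      filter_upwards [hg, hH (hm.toLp _), hm.coeFn_toLp, hs] with x h1 h2 h3 h4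
      rw [h1, h2, h3, h4, mul_assoc, hss]
    rw [hgH, hv]
    refine integral_congr_ae ?_
    filter_upwards [hm.coeFn_toLp] with x hx
    rw [hx]; ring
  have hbound : (fun x => |v x * s x|) ≤ᵐ[μ] fun x => ‖ξ‖ * w x := by
    obtain ⟨σ, hσ1, hσ⟩ := exists_sign (μ := μ) hvi.aestronglyMeasurable
    refine ae_le_of_forall_integral_indicator_le hvi.abs (hw.const_mul _) fun A hA e he _ => ?_
    have hi := integrable_mul_of_integrable (e * σ) hw
    have h1 := hξ (e * σ) (hi.toL1 _) hi.coeFn_toL1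
    have h2 : ∫ x, (e * σ) x * (v x * s x) ∂μ = ∫ x, e x * |v x * s x| ∂μ := by
      refine integral_congr_ae ?_
      filter_upwards [hσ, coe_mul e σ] with x hx hx'
      rw [hx', mul_assoc, hx]
    have h3 : ∫ x, e x * (‖ξ‖ * w x) ∂μ = ‖ξ‖ * ∫ x, e x * w x ∂μ := by
      rw [← integral_const_mul]
      exact integral_congr_ae (.of_forall fun x => by ring)
    rw [← h2, ← h1, h3]
    refine (le_abs_self _).trans ((ξ.le_opNorm _).trans ?_)
    rw [L1.norm_eq_integral_norm]
    refine mul_le_mul_of_nonneg_left (integral_mono_ae (L1.integrable_coeFn _).norm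
      (integrable_mul_of_integrable e hw) ?_) (norm_nonneg _)
    filter_upwards [hi.coeFn_toL1, he, ae_abs_le σ, coe_mul e σ] with x hx hx' hx'' hx3
    have hs' : |σ x| ≤ 1 := hx''.trans hσ1
    show ‖_‖ ≤ _
    rw [hx, hx3, hx']
    by_cases hxA : x ∈ A
    · simp only [hxA, Set.indicator_of_mem, Pi.one_apply, one_mul, Real.norm_eq_abs, abs_mul,
        abs_of_pos (hpos x)]
      exact mul_le_of_le_one_left (hpos x).le hs'
    · simp [hxA]
  obtain ⟨f, hf⟩ := exists_coe_ae_eq (μ := μ) (f := fun x => v x * s x / w x) (C := ‖ξ‖)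
    (hvi.aemeasurable.div mw.aemeasurable).aestronglyMeasurable (by
      filter_upwards [hbound] with x hx
      rw [abs_div, abs_of_pos (hpos x), div_le_iff₀ (hpos x)]
      exact hx)
  refine ⟨f, fun g => ?_⟩
  -- both sides are continuous in `g`, and bounded multiples of `w` are dense in `L^1`
  rw [← sub_eq_zero, ← abs_nonpos_iff]
  refine le_of_forall_pos_le_add fun ε hε => ?_
  have hgi := L1.integrable_coeFn g
  obtain ⟨u, hu⟩ := exists_mul_approx hw hgi
    (.of_forall fun x hx => absurd hx (hpos x).ne') (ε := ε / (‖ξ‖ + ‖f‖ + 1)) (by positivity)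
  have hui := integrable_mul_of_integrable u hw
  have h1 : ξ (hui.toL1 _) = ∫ x, f x * (hui.toL1 _) x ∂μ := by
    rw [hξ u _ hui.coeFn_toL1]
    refine integral_congr_ae ?_
    filter_upwards [hf, hui.coeFn_toL1] with x h2 h3
    rw [h2, h3]
    field_simp [(hpos x).ne']
  have h2 : ‖g - hui.toL1 _‖ < ε / (‖ξ‖ + ‖f‖ + 1) := by
    refine lt_of_eq_of_lt ?_ hu
    rw [L1.norm_eq_integral_norm]
    refine integral_congr_ae ?_
    filter_upwards [Lp.coeFn_sub g (hui.toL1 _), hui.coeFn_toL1] with x h2 h3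
    rw [h2, Pi.sub_apply, h3, Real.norm_eq_abs]
  have h3 : ξ g - ∫ x, f x * g x ∂μ =
      ξ (g - hui.toL1 _) - l1ToDual μ (g - hui.toL1 _) f := by
    rw [map_sub, map_sub, sub_apply, l1ToDual_apply, l1ToDual_apply, ← h1]; ring
  have h4 := ξ.le_opNorm (g - hui.toL1 _)
  have h5 := (l1ToDual μ (g - hui.toL1 _)).le_opNorm f
  rw [norm_l1ToDual] at h5
  rw [h3, zero_add]
  refine (abs_sub _ _).trans ?_
  rw [Real.norm_eq_abs] at h4 h5
  rw [lt_div_iff₀ (by positivity)] at h2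
  nlinarith [norm_nonneg (g - hui.toL1 _)]

end Duality

/-! ### Weak* topologies -/

section WeakStar

variable {F : Type v} [NormedAddCommGroup F] [NormedSpace ℝ F]
  {G : Type w} [NormedAddCommGroup G] [NormedSpace ℝ G]

/-- A functional which is weak*-continuous relative to `P` belongs to `P`. -/
theorem mem_of_continuous_weakStar {P : Submodule ℝ (StrongDual ℝ F)} {q : StrongDual ℝ F}
    (h : Continuous[weakStar P, inferInstance] q) : q ∈ P := by
  let f : P → F →ₗ[ℝ] ℝ := fun p => ((p : StrongDual ℝ F) : F →ₗ[ℝ] ℝ)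
  have hmem : (q : F →ₗ[ℝ] ℝ) ∈ Submodule.span ℝ (Set.range f) := by
    rw [LinearMap.mem_span_iff_continuous]
    convert h using 1
    swap
    · rfl
    rw [weakStar, Pi.topologicalSpace, induced_iInf]
    simp only [induced_compose]
    rfl
  have hle : Submodule.span ℝ (Set.range f) ≤
      P.map (ContinuousLinearMap.coeLM ℝ : StrongDual ℝ F →ₗ[ℝ] F →ₗ[ℝ] ℝ) := by
    rw [Submodule.span_le]
    rintro _ ⟨p, rfl⟩
    exact ⟨p, p.2, rfl⟩
  obtain ⟨p, hp, hpq⟩ := hle hmem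
  rwa [← ContinuousLinearMap.coe_injective hpq]

theorem continuous_weakStar_of_mem {P : Submodule ℝ (StrongDual ℝ F)} {p : StrongDual ℝ F}
    (hp : p ∈ P) : Continuous[weakStar P, inferInstance] p :=
  @Continuous.comp F (P → ℝ) ℝ (weakStar P) _ _ _ _ (continuous_apply (⟨p, hp⟩ : P))
    continuous_induced_dom

/-- A bounded linear map is weak*-continuous if and only if its adjoint maps the predual of the
target to the predual of the source. -/
theorem continuous_weakStar_iff_comp_mem {Q : Submodule ℝ (StrongDual ℝ F)}
    {P : Submodule ℝ (StrongDual ℝ G)} (A : F →L[ℝ] G) :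
    Continuous[weakStar Q, weakStar P] A ↔ ∀ p ∈ P, p.comp A ∈ Q := by
  rw [continuous_weakStar_iff]
  exact ⟨fun h p hp => mem_of_continuous_weakStar (h p hp),
    fun h p hp => continuous_weakStar_of_mem (h p hp)⟩

theorem comp_mem_of_mem_closure_span {Q : Submodule ℝ (StrongDual ℝ F)}
    (hQ : IsClosed (Q : Set (StrongDual ℝ F))) (A : F →L[ℝ] G) {S : Set (StrongDual ℝ G)}
    (h : ∀ p ∈ S, p.comp A ∈ Q) {p : StrongDual ℝ G}
    (hp : p ∈ (Submodule.span ℝ S).topologicalClosure) : p.comp A ∈ Q := by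
  let R : StrongDual ℝ G →L[ℝ] StrongDual ℝ F := (ContinuousLinearMap.compL ℝ F G ℝ).flip A
  have hle : (Submodule.span ℝ S).topologicalClosure ≤ Q.comap (R : StrongDual ℝ G →ₗ[ℝ] _) :=
    Submodule.topologicalClosure_minimal _ (Submodule.span_le.2 h) (hQ.preimage R.continuous)
  exact hle hp

end WeakStar

/-! ### Projections in `L^∞` -/

section Projections

variable {M : Type u} [MeasurableSpace M] {μ : Measure M}

namespace LInfty

theorem ae_eq_zero_or_one {p : LInfty μ} (hp : p * p = p) : ∀ᵐ x ∂μ, p x = 0 ∨ p x = 1 := by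
  have h := coe_mul p p
  rw [hp] at h
  filter_upwards [h] with x hx
  have : p x * (p x - 1) = 0 := by rw [mul_sub, ← hx]; ring
  rcases mul_eq_zero.1 this with h0 | h1
  · exact Or.inl h0
  · exact Or.inr (by linarith)

theorem norm_le_one_of_mul_self {p : LInfty μ} (hp : p * p = p) : ‖p‖ ≤ 1 := by
  refine norm_le_of_ae zero_le_one ?_
  filter_upwards [ae_eq_zero_or_one hp] with x hx
  rcases hx with hx | hx <;> simp [hx]

theorem one_sub_mul_self {p : LInfty μ} (hp : p * p = p) : (1 - p) * (1 - p) = 1 - p := by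
  linear_combination hp

theorem norm_le_max {p : LInfty μ} (hp : p * p = p) (g : LInfty μ) :
    ‖g‖ ≤ max ‖p * g‖ ‖(1 - p) * g‖ := by
  refine norm_le_of_ae (le_max_of_le_left (norm_nonneg _)) ?_
  have hadd := coe_add (p * g) ((1 - p) * g)
  rw [← add_mul, add_sub_cancel, one_mul] at hadd
  filter_upwards [ae_eq_zero_or_one hp, ae_abs_le (p * g), ae_abs_le ((1 - p) * g),
    coe_mul p g, hadd] with x h0 h1 h2 h3 h4
  rcases h0 with h0 | h0
  · have : g x = ((1 - p) * g) x := by rw [h4, h3, h0]; ring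
    rw [this]
    exact le_max_of_le_right h2
  · have : g x = (p * g) x := by rw [h3, h0]; ring
    rw [this]
    exact le_max_of_le_left h1

end LInfty

end Projections

/-! ### Dual modules -/

section DualModules

variable {M : Type u} [MeasurableSpace M] {μ : Measure M}
  {E : Type v} [NormedAddCommGroup E] [NormedSpace ℝ E] [Module (LInfty μ) E]

namespace DualModule

theorem ext {Φ Ψ : DualModule μ E} (h : ∀ φ, Φ.toCLM φ = Ψ.toCLM φ) : Φ = Ψ :=
  Subtype.ext (ContinuousLinearMap.ext h)

theorem norm_toCLM (Φ : DualModule μ E) : ‖Φ.toCLM‖ = ‖Φ‖ := rfl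

theorem toCLM_smul (Φ : DualModule μ E) (f : LInfty μ) (φ : E) :
    Φ.toCLM (f • φ) = f * Φ.toCLM φ := Φ.2 f φ

instance : IsScalarTower ℝ (LInfty μ) (DualModule μ E) :=
  ⟨fun c f Φ => ext fun φ => smul_mul_assoc c f (Φ.toCLM φ)⟩

instance : IsBoundedSMul (LInfty μ) (DualModule μ E) :=
  IsBoundedSMul.of_norm_smul_le fun f Φ =>
    ContinuousLinearMap.opNorm_le_bound _ (mul_nonneg (norm_nonneg _) (norm_nonneg _)) fun φ => by
      refine (norm_mul_le f (Φ.toCLM φ)).trans ?_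
      rw [mul_assoc]
      exact mul_le_mul_of_nonneg_left (Φ.toCLM.le_opNorm φ) (norm_nonneg f)

instance : CompleteSpace (DualModule μ E) := by
  have hc : IsClosed {Φ : E →L[ℝ] LInfty μ | ∀ (f : LInfty μ) (φ : E), Φ (f • φ) = f * Φ φ} := by
    simp only [Set.ofPred_forall]
    refine isClosed_iInter fun f => isClosed_iInter fun φ => isClosed_eq ?_ ?_
    · exact (ContinuousLinearMap.apply ℝ (LInfty μ) (f • φ)).continuous
    · exact continuous_const.mul (ContinuousLinearMap.apply ℝ (LInfty μ) φ).continuous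
  exact hc.completeSpace_coe

/-- Evaluation of the members of the dual module at an element of the module. -/
noncomputable def eval (μ : Measure M) {E : Type v} [NormedAddCommGroup E] [NormedSpace ℝ E]
    [Module (LInfty μ) E] (φ : E) : DualModule μ E →L[ℝ] LInfty μ :=
  LinearMap.mkContinuous
    { toFun := fun Φ => Φ.toCLM φ
      map_add' := fun _ _ => rfl
      map_smul' := fun _ _ => rfl } ‖φ‖
    (fun Φ => by rw [mul_comm]; exact Φ.toCLM.le_opNorm φ)

theorem eval_apply (φ : E) (Φ : DualModule μ E) : eval μ φ Φ = Φ.toCLM φ := rfl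

theorem norm_eval_le (φ : E) : ‖eval μ φ‖ ≤ ‖φ‖ :=
  ContinuousLinearMap.opNorm_le_bound _ (norm_nonneg φ) fun Φ => by
    rw [mul_comm]; exact Φ.toCLM.le_opNorm φ

theorem comp_eval_mem (φ : E) {p : StrongDual ℝ (LInfty μ)} (hp : p ∈ linftyPredual μ) :
    p.comp (eval μ φ) ∈ predual μ E :=
  Submodule.le_topologicalClosure _ (Submodule.subset_span ⟨φ, p, hp, fun _ => rfl⟩)

/-- A weak*-continuity criterion: to map the predual of a dual module into a closed space `Q`, the
adjoint of a bounded linear map only has to map the functionals `Φ ↦ ∫ Φ(φ) g dμ` into `Q`. -/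
theorem comp_mem_of_forall_eval {F : Type w} [NormedAddCommGroup F] [NormedSpace ℝ F]
    {Q : Submodule ℝ (StrongDual ℝ F)} (hQ : IsClosed (Q : Set (StrongDual ℝ F)))
    (A : F →L[ℝ] DualModule μ E)
    (h : ∀ φ : E, ∀ p ∈ linftyPredual μ, (p.comp (eval μ φ)).comp A ∈ Q) :
    ∀ p ∈ predual μ E, p.comp A ∈ Q := fun _ hp => by
  refine comp_mem_of_mem_closure_span hQ A ?_ hp
  rintro ℓ ⟨φ, p, hp, hℓ⟩
  convert h φ p hp using 1
  exact ContinuousLinearMap.ext fun x => hℓ (A x)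

theorem norm_eq_max (p : LInfty μ) (hp : p * p = p) (Φ : DualModule μ E) :
    ‖Φ‖ = max ‖p • Φ‖ ‖(1 - p) • Φ‖ := by
  refine le_antisymm ?_ (max_le ?_ ?_)
  · refine ContinuousLinearMap.opNorm_le_bound _ (le_max_of_le_left (norm_nonneg _)) fun φ => ?_
    refine (LInfty.norm_le_max hp (Φ.toCLM φ)).trans (max_le ?_ ?_)
    · exact ((p • Φ).toCLM.le_opNorm φ).trans
        (mul_le_mul_of_nonneg_right (le_max_left _ _) (norm_nonneg φ))
    · exact (((1 - p) • Φ).toCLM.le_opNorm φ).trans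
        (mul_le_mul_of_nonneg_right (le_max_right _ _) (norm_nonneg φ))
  · exact (norm_smul_le p Φ).trans (mul_le_of_le_one_left (norm_nonneg _)
      (LInfty.norm_le_one_of_mul_self hp))
  · exact (norm_smul_le (1 - p) Φ).trans (mul_le_of_le_one_left (norm_nonneg _)
      (LInfty.norm_le_one_of_mul_self (LInfty.one_sub_mul_self hp)))

/-- Every bounded functional on the predual of a dual module is evaluation at a member `Φ` of the
dual module: `Φ(φ)` is the element of `L^∞` that represents the functional sending `g ∈ L^1` to the
value of the given one at `Ψ ↦ ∫ Ψ(φ) g dμ`. -/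
theorem exists_eq_eval_of_bounded [SigmaFinite μ] (ξ : predual μ E →ₗ[ℝ] ℝ) (C : ℝ)
    (hC : ∀ p : predual μ E, |ξ p| ≤ C * ‖(p : StrongDual ℝ (DualModule μ E))‖) :
    ∃ Φ : DualModule μ E, ∀ p : predual μ E, ξ p = (p : StrongDual ℝ (DualModule μ E)) Φ := by
  obtain ⟨η, hη, -⟩ := exists_extension_norm_eq (predual μ E) (ξ.mkContinuous C hC)
  have hη' : ∀ p : predual μ E, η p = ξ p := hη
  have hC0 : ∀ p ∈ predual μ E, |η p| ≤ max C 0 * ‖p‖ := fun p hp => by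
    rw [hη' ⟨p, hp⟩]
    exact (hC ⟨p, hp⟩).trans (mul_le_mul_of_nonneg_right (le_max_left _ _) (norm_nonneg p))
  have hmem : ∀ (φ : E) (g : Lp ℝ 1 μ), (l1ToDual μ g).comp (eval μ φ) ∈ predual μ E :=
    fun φ g => comp_eval_mem φ (l1ToDual_mem g)
  have hb : ∀ (φ : E) (g : Lp ℝ 1 μ),
      |η ((l1ToDual μ g).comp (eval μ φ))| ≤ max C 0 * ‖φ‖ * ‖g‖ := fun φ g => by
    refine (hC0 _ (hmem φ g)).trans ?_
    rw [mul_assoc, mul_comm ‖φ‖]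
    refine mul_le_mul_of_nonneg_left ?_ (le_max_right _ _)
    refine (ContinuousLinearMap.opNorm_comp_le _ _).trans ?_
    rw [norm_l1ToDual]
    exact mul_le_mul_of_nonneg_left (norm_eval_le φ) (norm_nonneg g)
  have hrep : ∀ φ : E, ∃ f : LInfty μ, ∀ g : Lp ℝ 1 μ,
      η ((l1ToDual μ g).comp (eval μ φ)) = ∫ x, f x * g x ∂μ := fun φ =>
    exists_linfty_of_dual_l1 (LinearMap.mkContinuous
      { toFun := fun g => η ((l1ToDual μ g).comp (eval μ φ))
        map_add' := fun g g' => by rw [map_add, ContinuousLinearMap.add_comp, map_add]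
        map_smul' := fun c g => by
          rw [map_smul, ContinuousLinearMap.smul_comp, map_smul, RingHom.id_apply] }
      (max C 0 * ‖φ‖) (hb φ))
  choose F hF using hrep
  have hFeq : ∀ {φ : E} {f : LInfty μ}, (∀ g : Lp ℝ 1 μ,
      η ((l1ToDual μ g).comp (eval μ φ)) = l1ToDual μ g f) → F φ = f := fun {φ f} h =>
    LInfty.eq_of_forall_integral_mul_eq fun g => (hF φ g).symm.trans (h g)
  have hF' : ∀ (φ : E) (g : Lp ℝ 1 μ),
      l1ToDual μ g (F φ) = η ((l1ToDual μ g).comp (eval μ φ)) := fun φ g => (hF φ g).symm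
  let Φ : DualModule μ E := ⟨LinearMap.mkContinuous
    { toFun := F
      map_add' := fun φ ψ => hFeq fun g => by
        rw [map_add, hF', hF', ← map_add]
        exact congrArg η (ContinuousLinearMap.ext fun Ψ => by
          simp [eval_apply])
      map_smul' := fun c φ => hFeq fun g => by
        rw [RingHom.id_apply, map_smul, hF', ← map_smul]
        exact congrArg η (ContinuousLinearMap.ext fun Ψ => by
          simp [eval_apply]) } (max C 0) (fun φ =>
      LInfty.norm_le_of_forall_abs_integral_mul_le
        (mul_nonneg (le_max_right _ _) (norm_nonneg φ)) fun g =>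
          (congrArg abs (hF φ g)).symm.trans_le (hb φ g)),
    fun f φ => hFeq fun g => by
      obtain ⟨q, hq, hqg⟩ := exists_linftyPredual_mul f (l1ToDual_mem g)
      obtain ⟨g', rfl⟩ := exists_l1ToDual_eq hq
      change _ = l1ToDual μ g (f * F φ)
      rw [← hqg, hF']
      refine congrArg η (ContinuousLinearMap.ext fun Ψ => ?_)
      simp only [ContinuousLinearMap.comp_apply, eval_apply, hqg, toCLM_smul]⟩
  refine ⟨Φ, fun p => ?_⟩
  rw [← hη' p]
  refine ContinuousLinearMap.eqOn_closure_span (f := η)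
    (g := ContinuousLinearMap.apply ℝ ℝ Φ) ?_ p.2
  rintro ℓ ⟨φ, q, hq, hℓ⟩
  obtain ⟨g, rfl⟩ := exists_l1ToDual_eq hq
  obtain rfl : ℓ = (l1ToDual μ g).comp (eval μ φ) := ContinuousLinearMap.ext hℓ
  exact (hF' φ g).symm

theorem isPredual [SigmaFinite μ] : IsPredual (predual μ E) where
  isClosed := Submodule.isClosed_topologicalClosure _
  isometric Φ := by
    constructor
    · rintro _ ⟨p, -, hp1, rfl⟩
      exact (p.le_opNorm Φ).trans (mul_le_of_le_one_left (norm_nonneg _) hp1)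
    · intro b hb
      have hb0 : 0 ≤ b := hb ⟨0, zero_mem _, by simp, by simp⟩
      refine ContinuousLinearMap.opNorm_le_bound _ hb0 fun φ => ?_
      refine LInfty.norm_le_of_forall_abs_integral_mul_le
        (mul_nonneg hb0 (norm_nonneg φ)) fun g => ?_
      have hn : ‖(l1ToDual μ g).comp (eval μ φ)‖ ≤ ‖φ‖ * ‖g‖ := by
        refine (ContinuousLinearMap.opNorm_comp_le _ _).trans ?_
        rw [norm_l1ToDual, mul_comm]
        exact mul_le_mul_of_nonneg_right (norm_eval_le φ) (norm_nonneg g)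
      have hm : (l1ToDual μ g).comp (eval μ φ) ∈ predual μ E := comp_eval_mem φ (l1ToDual_mem g)
      change |((l1ToDual μ g).comp (eval μ φ)) Φ| ≤ _
      rw [mul_assoc]
      generalize (l1ToDual μ g).comp (eval μ φ) = q at hn hm
      refine le_trans ?_ (mul_le_mul_of_nonneg_left hn hb0)
      rcases eq_or_ne q 0 with rfl | hq
      · simp
      have hq0 : 0 < ‖q‖ := norm_pos_iff.2 hq
      have := hb ⟨‖q‖⁻¹ • q, Submodule.smul_mem _ _ hm, by
        rw [norm_smul, norm_inv, norm_norm, inv_mul_cancel₀ hq0.ne'], rfl⟩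
      rw [smul_apply, smul_eq_mul, abs_mul, abs_inv, abs_norm,
        inv_mul_le_iff₀ hq0] at this
      linarith
  surjective ξ := fun ⟨C, hC⟩ => exists_eq_eval_of_bounded ξ C hC

/-- The dual of a normed module over `L^∞` is an abelian W*-module. -/
theorem isAbelianWStarModule [SigmaFinite μ] : IsAbelianWStarModule μ (predual μ E) where
  isScalarTower := inferInstance
  completeSpace := inferInstance
  norm_smul_le f Φ := _root_.norm_smul_le f Φ
  norm_eq_max := norm_eq_max
  isPredual := isPredual
  continuous_smul_left Φ := by
    refine (continuous_weakStar_iff_comp_mem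
      ((ContinuousLinearMap.lsmul ℝ (LInfty μ)).flip Φ)).2 ?_
    refine comp_mem_of_forall_eval isClosed_linftyPredual _ fun φ p hp => ?_
    obtain ⟨q, hq, hqp⟩ := exists_linftyPredual_mul (Φ.toCLM φ) hp
    convert hq using 1
    refine ContinuousLinearMap.ext fun f => ?_
    rw [hqp, mul_comm]
    rfl
  continuous_smul_right f := by
    refine (continuous_weakStar_iff_comp_mem (ContinuousLinearMap.lsmul ℝ (LInfty μ) f)).2 ?_
    refine comp_mem_of_forall_eval (Submodule.isClosed_topologicalClosure _) _ fun φ p hp => ?_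
    obtain ⟨q, hq, hqp⟩ := exists_linftyPredual_mul f hp
    have heq : (p.comp (eval μ φ)).comp (ContinuousLinearMap.lsmul ℝ (LInfty μ) f) =
        q.comp (eval μ φ) := ContinuousLinearMap.ext fun Φ => (hqp _).symm
    exact heq ▸ comp_eval_mem φ hq

end DualModule

end DualModules

/-! ### Abelian W*-modules as dual modules -/

section NormalDual

variable {M : Type u} [MeasurableSpace M] {μ : Measure M}
  {E : Type v} [NormedAddCommGroup E] [NormedSpace ℝ E] [Module (LInfty μ) E]

open LInfty

namespace LInfty

theorem coe_sum {ι : Type*} (s : Finset ι) (f : ι → LInfty μ) :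
    ((∑ i ∈ s, f i : LInfty μ) : M → ℝ) =ᵐ[μ] fun x => ∑ i ∈ s, f i x := by
  classical
  induction s using Finset.induction_on with
  | empty => simpa using coe_zero
  | insert a s ha ih =>
    rw [Finset.sum_insert ha]
    filter_upwards [coe_add (f a) (∑ i ∈ s, f i), ih] with x h1 h2
    rw [h1, h2, Finset.sum_insert ha]

end LInfty

/-- A relation `∑ i, ∫ Φᵢ(φ) hᵢ = 0` between functionals on a module comes from a relation
`∑ i, uᵢ Φᵢ = 0` over `L^∞`: take `uᵢ = hᵢ / k` with `k = ∑ i, |hᵢ|`. -/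
theorem DualModule.exists_sum_smul_eq_zero {ι : Type*} [Fintype ι] (Φ : ι → DualModule μ E)
    {h : ι → M → ℝ} (hh : ∀ i, Integrable (h i) μ)
    (hsum : ∀ φ : E, ∑ i, ∫ x, (Φ i).toCLM φ x * h i x ∂μ = 0) :
    ∃ (u : ι → LInfty μ) (k : M → ℝ), Integrable k μ ∧ (∀ i, h i =ᵐ[μ] fun x => u i x * k x) ∧
      ∑ i, u i • Φ i = 0 := by
  let k : M → ℝ := fun x => ∑ i, |h i x|
  have hk : Integrable k μ := integrable_finsetSum _ fun i _ => (hh i).abs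
  have hle : ∀ i x, |h i x| ≤ k x := fun i x =>
    Finset.single_le_sum (f := fun i => |h i x|) (fun j _ => abs_nonneg _) (Finset.mem_univ i)
  have hex : ∀ i, ∃ u : LInfty μ, (u : M → ℝ) =ᵐ[μ] fun x => h i x / k x := fun i =>
    exists_coe_ae_eq (C := 1) ((hh i).aemeasurable.div hk.aemeasurable).aestronglyMeasurable
      (.of_forall fun x => by
        rw [abs_div]
        exact div_le_one_of_le₀ ((hle i x).trans (le_abs_self _)) (abs_nonneg _))
  choose u hu using hex
  have huk : ∀ i, h i =ᵐ[μ] fun x => u i x * k x := fun i => by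
    filter_upwards [hu i] with x hx
    rw [hx]
    by_cases h0 : k x = 0
    · have := (hle i x).trans_eq h0
      rw [h0, mul_zero, abs_nonpos_iff.1 this]
    · rw [div_mul_cancel₀ _ h0]
  refine ⟨u, k, hk, huk, DualModule.ext fun φ => ?_⟩
  have hev : (∑ i, u i • Φ i).toCLM φ = ∑ i, u i * (Φ i).toCLM φ := by
    rw [← eval_apply, map_sum]
    rfl
  rw [hev]
  change _ = (0 : LInfty μ)
  have hae : (fun x => (∑ i, u i * (Φ i).toCLM φ) x * k x) =ᵐ[μ] fun _ => 0 := by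
    refine ae_eq_of_forall_integral_mul_eq (integrable_mul_of_integrable _ hk)
      (integrable_zero _ _ _) fun g => ?_
    have h1 : ∫ x, g x * ((∑ i, u i * (Φ i).toCLM φ) x * k x) ∂μ =
        ∑ i, ∫ x, (Φ i).toCLM (g • φ) x * h i x ∂μ := by
      rw [← integral_finsetSum _ fun i _ => integrable_mul_of_integrable _ (hh i)]
      refine integral_congr_ae ?_
      have h2 : ∀ᵐ x ∂μ, ∀ i, (u i * (Φ i).toCLM φ) x = u i x * (Φ i).toCLM φ x ∧
          (g * (Φ i).toCLM φ) x = g x * (Φ i).toCLM φ x ∧ h i x = u i x * k x :=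
        ae_all_iff.2 fun i => (coe_mul _ _).and ((coe_mul _ _).and (huk i))
      filter_upwards [h2, coe_sum Finset.univ fun i => u i * (Φ i).toCLM φ] with x h3 h4
      rw [h4, Finset.sum_mul, Finset.mul_sum]
      refine Finset.sum_congr rfl fun i _ => ?_
      obtain ⟨h5, h6, h7⟩ := h3 i
      rw [toCLM_smul, h5, h6, h7]; ring
    rw [h1, hsum]
    simp
  refine LInfty.ext ?_
  have h2 : ∀ᵐ x ∂μ, ∀ i, (u i * (Φ i).toCLM φ) x = u i x * (Φ i).toCLM φ x ∧
      u i x = h i x / k x := ae_all_iff.2 fun i => (coe_mul _ _).and (hu i)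
  filter_upwards [hae, h2, coe_sum Finset.univ fun i => u i * (Φ i).toCLM φ,
    coe_zero (μ := μ)] with x h3 h4 h5 h6
  rw [h6]
  rcases mul_eq_zero.1 h3 with h0 | h0
  · exact h0
  · rw [h5]
    refine Finset.sum_eq_zero fun i _ => ?_
    rw [(h4 i).1, (h4 i).2, h0, div_zero, zero_mul]

/-- The weak*-continuous bounded `L^∞`-module homomorphisms from `E` to `L^∞`, where the weak*
topology of `E` comes from `P`. -/
def normalDual (μ : Measure M) {E : Type v} [NormedAddCommGroup E] [NormedSpace ℝ E]
    [Module (LInfty μ) E] (P : Submodule ℝ (StrongDual ℝ E)) :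
    Submodule (LInfty μ) (DualModule μ E) where
  carrier := {Φ | ∀ q ∈ linftyPredual μ, q.comp Φ.toCLM ∈ P}
  zero_mem' q _ := by
    convert P.zero_mem
    exact ContinuousLinearMap.ext fun φ => map_zero q
  add_mem' {Φ Ψ} hΦ hΨ q hq := by
    convert P.add_mem (hΦ q hq) (hΨ q hq) using 1
    exact ContinuousLinearMap.ext fun φ => map_add q _ _
  smul_mem' f Φ hΦ q hq := by
    obtain ⟨q', hq', hqq'⟩ := exists_linftyPredual_mul f hq
    convert hΦ q' hq' using 1
    exact ContinuousLinearMap.ext fun φ => (hqq' _).symm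

/-- The integral `∑ i, ∫ L(Φᵢ) hᵢ` of a module map `L` depends only on the functional
`φ ↦ ∑ i, ∫ Φᵢ(φ) hᵢ`. -/
theorem normalDual.sum_integral_map_eq_zero {ι : Type*} [Fintype ι]
    {P : Submodule ℝ (StrongDual ℝ E)}
    (L : normalDual μ P →ₗ[LInfty μ] LInfty μ) (Φ : ι → normalDual μ P)
    {h : ι → M → ℝ} (hh : ∀ i, Integrable (h i) μ)
    (hsum : ∀ φ : E, ∑ i, ∫ x, (Φ i).1.toCLM φ x * h i x ∂μ = 0) :
    ∑ i, ∫ x, L (Φ i) x * h i x ∂μ = 0 := by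
  obtain ⟨u, k, hk, hu, h0⟩ := DualModule.exists_sum_smul_eq_zero (fun i => (Φ i).1) hh hsum
  have h1 : ∑ i, u i * L (Φ i) = 0 := by
    have h2 : ∑ i, u i • Φ i = 0 := Subtype.ext (by simpa using h0)
    simpa only [map_sum, map_smul, smul_eq_mul, map_zero] using congrArg L h2
  rw [← integral_finsetSum _ fun i _ => integrable_mul_of_integrable _ (hh i)]
  have h3 : ∀ᵐ x ∂μ, ∀ i, (u i * L (Φ i)) x = u i x * L (Φ i) x ∧ h i x = u i x * k x :=
    ae_all_iff.2 fun i => (coe_mul _ _).and (hu i)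
  have h4 := coe_sum Finset.univ fun i => u i * L (Φ i)
  rw [h1] at h4
  refine (integral_congr_ae (g := fun _ => 0) ?_).trans (by simp)
  filter_upwards [h3, h4, coe_zero (μ := μ)] with x h5 h6 h7
  have h8 : ∑ i, L (Φ i) x * h i x = (∑ i, (u i * L (Φ i)) x) * k x := by
    rw [Finset.sum_mul]
    exact Finset.sum_congr rfl fun i _ => by rw [(h5 i).1, (h5 i).2]; ring
  rw [h8, ← h6, h7, zero_mul]

theorem normalDual.integral_map_eq {P : Submodule ℝ (StrongDual ℝ E)}
    (L : normalDual μ P →ₗ[LInfty μ] LInfty μ) {Φ Ψ : normalDual μ P}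
    {h l : M → ℝ} (hh : Integrable h μ) (hl : Integrable l μ)
    (heq : ∀ φ : E, ∫ x, Φ.1.toCLM φ x * h x ∂μ = ∫ x, Ψ.1.toCLM φ x * l x ∂μ) :
    ∫ x, L Φ x * h x ∂μ = ∫ x, L Ψ x * l x ∂μ := by
  have := normalDual.sum_integral_map_eq_zero L ![Φ, Ψ] (h := ![h, -l])
    (fun i => by fin_cases i; exacts [hh, hl.neg]) (fun φ => by
      simp [heq φ, integral_neg])
  simp [integral_neg] at this
  linarith

namespace IsAbelianWStarModule

variable {P : Submodule ℝ (StrongDual ℝ E)}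

theorem exists_predual_smul (hE : IsAbelianWStarModule μ P) (f : LInfty μ)
    {p : StrongDual ℝ E} (hp : p ∈ P) :
    ∃ q ∈ P, ∀ φ, q φ = p (f • φ) := by
  have := hE.isScalarTower
  have : IsBoundedSMul (LInfty μ) E := IsBoundedSMul.of_norm_smul_le hE.norm_smul_le
  exact ⟨_, (continuous_weakStar_iff_comp_mem (ContinuousLinearMap.lsmul ℝ (LInfty μ) f)).1
    (hE.continuous_smul_right f) p hp, fun φ => rfl⟩

theorem exists_density (hE : IsAbelianWStarModule μ P) {p : StrongDual ℝ E} (hp : p ∈ P) (φ : E) :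
    ∃ k : M → ℝ, Integrable k μ ∧ ∀ f : LInfty μ, p (f • φ) = ∫ x, f x * k x ∂μ := by
  have := hE.isScalarTower
  have : IsBoundedSMul (LInfty μ) E := IsBoundedSMul.of_norm_smul_le hE.norm_smul_le
  exact mem_linftyPredual_iff.1 ((continuous_weakStar_iff_comp_mem
    ((ContinuousLinearMap.lsmul ℝ (LInfty μ)).flip φ)).1 (hE.continuous_smul_left φ) p hp)

theorem exists_norm_attained (hE : IsAbelianWStarModule μ P) {p : StrongDual ℝ E} (hp : p ∈ P) :
    ∃ φ : E, ‖φ‖ ≤ 1 ∧ p φ = ‖p‖ := by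
  obtain ⟨ξ, hξ1, hξ⟩ := exists_dual_vector'' ℝ (⟨p, hp⟩ : P)
  obtain ⟨φ, hφ⟩ := hE.isPredual.surjective (ξ : P →ₗ[ℝ] ℝ) ⟨‖ξ‖, fun q => ξ.le_opNorm q⟩
  refine ⟨φ, (hE.isPredual.isometric φ).2 ?_, (hφ ⟨p, hp⟩).symm.trans hξ⟩
  rintro _ ⟨q, hq, hq1, rfl⟩
  rw [← hφ ⟨q, hq⟩]
  exact (ξ.le_opNorm ⟨q, hq⟩).trans (mul_le_one₀ hξ1 (norm_nonneg (⟨q, hq⟩ : P)) hq1)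

theorem ext_predual (hE : IsAbelianWStarModule μ P) {φ ψ : E} (h : ∀ p ∈ P, p φ = p ψ) : φ = ψ := by
  rw [← sub_eq_zero, ← norm_le_zero_iff]
  refine (hE.isPredual.isometric (φ - ψ)).2 ?_
  rintro _ ⟨p, hp, -, rfl⟩
  rw [map_sub, h p hp, sub_self, abs_zero]

/-- Since the module is `L^∞`-normed, an element at which a functional attains its norm maximizes
the functional on each part of the space separately. -/
theorem apply_smul_le (hE : IsAbelianWStarModule μ P) {p : StrongDual ℝ E} {φ₀ : E}
    (h1 : ‖φ₀‖ ≤ 1) (h2 : p φ₀ = ‖p‖) {e : LInfty μ} (he : e * e = e) (φ : E) :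
    p (e • φ) ≤ ‖φ‖ * p (e • φ₀) := by
  have := hE.isScalarTower
  have he' : (1 - e) * (1 - e) = 1 - e := one_sub_mul_self he
  have hee : e * (1 - e) = 0 := by linear_combination -he
  have hee' : (1 - e) * e = 0 := by linear_combination -he
  -- paste `φ` on `e` and a multiple of `φ₀` on the complement
  set ψ : E := e • φ + (1 - e) • (‖φ‖ • φ₀) with hψ
  have hψn : ‖ψ‖ ≤ ‖φ‖ := by
    rw [hE.norm_eq_max e he ψ]
    have e1 : e • ψ = e • φ := by
      rw [hψ, smul_add, smul_smul, smul_smul, he, hee, zero_smul, add_zero]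
    have e2 : (1 - e) • ψ = (1 - e) • (‖φ‖ • φ₀) := by
      rw [hψ, smul_add, smul_smul, smul_smul, he', hee', zero_smul, zero_add]
    rw [e1, e2]
    refine max_le ?_ ?_
    · rw [hE.norm_eq_max e he φ]; exact le_max_left _ _
    · have h3 : ‖(1 - e) • (‖φ‖ • φ₀)‖ ≤ ‖‖φ‖ • φ₀‖ := by
        rw [hE.norm_eq_max e he (‖φ‖ • φ₀)]; exact le_max_right _ _
      refine h3.trans ?_
      rw [norm_smul, norm_norm]
      exact mul_le_of_le_one_right (norm_nonneg _) h1
  have h3 : p ψ ≤ ‖p‖ * ‖φ‖ :=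
    ((le_abs_self _).trans (p.le_opNorm ψ)).trans (mul_le_mul_of_nonneg_left hψn (norm_nonneg _))
  have h4 : p ψ = p (e • φ) + ‖φ‖ * (p φ₀ - p (e • φ₀)) := by
    rw [hψ, map_add, smul_comm (1 - e), map_smul p ‖φ‖, smul_eq_mul, sub_smul, one_smul, map_sub]
  rw [h4, h2] at h3
  linarith

/-- Each functional in the predual of an abelian W*-module factors through `L^∞`, as
`φ ↦ ∫ Φ(φ) h dμ` with a weak*-continuous homomorphism `Φ` of norm at most one and
`‖h‖₁ = ‖p‖`. Here `h` is the density of `f ↦ p (f φ₀)`, where `φ₀` is an element of the unit ball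
at which `p` attains its norm; it dominates all the other densities. -/
theorem exists_factorization (hE : IsAbelianWStarModule μ P) {p : StrongDual ℝ E} (hp : p ∈ P) :
    ∃ Φ ∈ normalDual μ P, ‖Φ‖ ≤ 1 ∧ ∃ h : M → ℝ, Integrable h μ ∧ ∫ x, |h x| ∂μ = ‖p‖ ∧
      ∀ φ, p φ = ∫ x, Φ.toCLM φ x * h x ∂μ := by
  have := hE.isScalarTower
  choose k hk hpk using hE.exists_density hp
  obtain ⟨φ₀, hφ₀, hpφ₀⟩ := hE.exists_norm_attained hp
  have kle : ∀ φ, (fun x => |k φ x|) ≤ᵐ[μ] fun x => ‖φ‖ * k φ₀ x := fun φ => by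
    have hi := (hk φ₀).const_mul ‖φ‖
    have e1 : ∀ e : LInfty μ, ∫ x, e x * (‖φ‖ * k φ₀ x) ∂μ = ‖φ‖ * p (e • φ₀) := fun e => by
      rw [hpk, ← integral_const_mul]
      exact integral_congr_ae (.of_forall fun x => by ring)
    have h1 : k φ ≤ᵐ[μ] fun x => ‖φ‖ * k φ₀ x := by
      refine ae_le_of_forall_integral_indicator_le (hk φ) hi fun A _ e _ he => ?_
      rw [e1, ← hpk]
      exact hE.apply_smul_le hφ₀ hpφ₀ he φ
    have h2 : (fun x => -k φ x) ≤ᵐ[μ] fun x => ‖φ‖ * k φ₀ x := by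
      refine ae_le_of_forall_integral_indicator_le (hk φ).neg hi fun A _ e _ he => ?_
      have := hE.apply_smul_le hφ₀ hpφ₀ he (-φ)
      rw [norm_neg, smul_neg, map_neg, hpk, ← integral_neg] at this
      rw [e1]
      simpa only [mul_neg] using this
    filter_upwards [h1, h2] with x h3 h4
    exact abs_le'.2 ⟨h3, h4⟩
  have kpos : ∀ᵐ x ∂μ, 0 ≤ k φ₀ x := by
    filter_upwards [kle φ₀] with x hx
    have h1 := neg_abs_le (k φ₀ x)
    nlinarith [norm_nonneg φ₀]
  have hex : ∀ φ, ∃ F : LInfty μ, (F : M → ℝ) =ᵐ[μ] fun x => k φ x / k φ₀ x := fun φ =>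
    exists_coe_ae_eq (C := ‖φ‖) ((hk φ).aemeasurable.div (hk φ₀).aemeasurable).aestronglyMeasurable
      (by
        filter_upwards [kle φ, kpos] with x h1 h2
        rw [abs_div, abs_of_nonneg h2]
        exact div_le_of_le_mul₀ h2 (norm_nonneg _) h1)
  choose F hF using hex
  have hFk : ∀ φ, (fun x => F φ x * k φ₀ x) =ᵐ[μ] k φ := fun φ => by
    filter_upwards [hF φ, kle φ] with x h1 h2
    rw [h1]
    by_cases h0 : k φ₀ x = 0
    · rw [h0, mul_zero] at h2
      rw [h0, mul_zero, abs_nonpos_iff.1 h2]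
    · rw [div_mul_cancel₀ _ h0]
  have hFn : ∀ φ, ‖F φ‖ ≤ ‖φ‖ := fun φ => norm_le_of_ae (norm_nonneg _) (by
    filter_upwards [hF φ, kle φ, kpos] with x h0 h1 h2
    rw [h0, abs_div, abs_of_nonneg h2]
    exact div_le_of_le_mul₀ h2 (norm_nonneg _) h1)
  have kadd : ∀ φ ψ, k (φ + ψ) =ᵐ[μ] fun x => k φ x + k ψ x := fun φ ψ => by
    refine ae_eq_of_forall_integral_mul_eq (hk _) ((hk φ).add (hk ψ)) fun f => ?_
    rw [← hpk, smul_add, map_add, hpk, hpk, ← integral_add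
      (integrable_mul_of_integrable f (hk φ)) (integrable_mul_of_integrable f (hk ψ))]
    exact integral_congr_ae (.of_forall fun x => (mul_add _ _ _).symm)
  have kmul : ∀ (f : LInfty μ) φ, k (f • φ) =ᵐ[μ] fun x => f x * k φ x := fun f φ => by
    refine ae_eq_of_forall_integral_mul_eq (hk _) (integrable_mul_of_integrable f (hk φ))
      fun g => ?_
    rw [← hpk, smul_smul, hpk]
    refine integral_congr_ae ?_
    filter_upwards [coe_mul g f] with x hx
    rw [hx, mul_assoc]
  have Fadd : ∀ φ ψ, F (φ + ψ) = F φ + F ψ := fun φ ψ => LInfty.ext (by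
    filter_upwards [hF (φ + ψ), hF φ, hF ψ, coe_add (F φ) (F ψ), kadd φ ψ] with x h1 h2 h3 h4 h5
    rw [h1, h4, h2, h3, h5, add_div])
  have Fmul : ∀ (f : LInfty μ) φ, F (f • φ) = f * F φ := fun f φ => LInfty.ext (by
    filter_upwards [hF (f • φ), hF φ, coe_mul f (F φ), kmul f φ] with x h1 h2 h3 h4
    rw [h1, h3, h2, h4, mul_div_assoc])
  let Φ : DualModule μ E := ⟨LinearMap.mkContinuous
    { toFun := F
      map_add' := Fadd
      map_smul' := fun c φ => by
        rw [RingHom.id_apply, ← one_smul (LInfty μ) φ, ← smul_assoc, Fmul, Fmul, smul_mul_assoc] } 1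
      (fun φ => by rw [one_mul]; exact hFn φ), Fmul⟩
  have hΦ : ∀ φ, Φ.toCLM φ = F φ := fun _ => rfl
  have hp1 : ∀ φ, p φ = ∫ x, k φ x ∂μ := fun φ => by
    rw [← one_smul (LInfty μ) φ, hpk, one_smul]
    refine integral_congr_ae ?_
    filter_upwards [coe_one (μ := μ)] with x hx
    rw [hx, one_mul]
  refine ⟨Φ, ?_, ContinuousLinearMap.opNorm_le_bound _ zero_le_one fun φ => ?_, k φ₀, hk φ₀, ?_,
    fun φ => ?_⟩
  · -- for `q = ∫ · l dμ` with `l` a bounded multiple of `k φ₀`, the composite `q ∘ Φ` is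
    -- a multiple of `p`; the general case follows by approximation
    intro q hq
    obtain ⟨l, hl, hql⟩ := mem_linftyPredual_iff.1 hq
    rw [← SetLike.mem_coe, ← hE.isPredual.isClosed.closure_eq, Metric.mem_closure_iff]
    intro ε hε
    obtain ⟨k₀, hk₀, hkk₀⟩ := (hk φ₀).aestronglyMeasurable
    have mZ : MeasurableSet {x | k₀ x ≠ 0} := (hk₀.measurable (measurableSet_singleton 0)).compl
    obtain ⟨u, hu⟩ := exists_mul_approx (hk φ₀) (hl.indicator mZ) (by
      filter_upwards [hkk₀] with x hx h0
      rw [hx] at h0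
      simp [h0]) (half_pos hε)
    obtain ⟨r, hr, hru⟩ := hE.exists_predual_smul u hp
    refine ⟨r, hr, lt_of_le_of_lt ?_ (half_lt_self hε)⟩
    rw [dist_eq_norm]
    refine ContinuousLinearMap.opNorm_le_bound _ (half_pos hε).le fun φ => ?_
    have hi := (hl.indicator mZ).sub (integrable_mul_of_integrable u (hk φ₀))
    have h1 : (q.comp Φ.toCLM - r) φ =
        ∫ x, F φ x * ({x | k₀ x ≠ 0}.indicator l x - u x * k φ₀ x) ∂μ := by
      rw [sub_apply, ContinuousLinearMap.comp_apply, hql, hru, hpk, hΦ,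
        ← integral_sub (integrable_mul_of_integrable _ hl) (integrable_mul_of_integrable _ (hk φ))]
      refine integral_congr_ae ?_
      filter_upwards [hFk φ, hF φ, hkk₀] with x h1 h2 h3
      rw [← h1]
      by_cases hx : k₀ x = 0
      · rw [h2, h3, hx]; simp
      · rw [Set.indicator_of_mem (by exact hx)]; ring
    rw [h1]
    refine (abs_integral_mul_le (F φ) hi).trans ?_
    rw [mul_comm]
    exact mul_le_mul hu.le (hFn φ) (norm_nonneg _) (half_pos hε).le
  · rw [one_mul]; exact hFn φ
  · rw [← hpφ₀, hp1]
    refine integral_congr_ae ?_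
    filter_upwards [kpos] with x hx
    exact abs_of_nonneg hx
  · rw [hp1]
    exact (integral_congr_ae (hFk φ)).symm

/-- An abelian W*-module is the dual module of its module of weak*-continuous homomorphisms
to `L^∞`. -/
theorem exists_eq_apply_of_bounded [SigmaFinite μ] (hE : IsAbelianWStarModule μ P)
    (L : normalDual μ P →ₗ[LInfty μ] LInfty μ)
    {C : ℝ} (hC : 0 ≤ C) (hL : ∀ Φ, ‖L Φ‖ ≤ C * ‖Φ.1‖) :
    ∃ φ : E, ‖φ‖ ≤ C ∧ ∀ Φ : normalDual μ P, Φ.1.toCLM φ = L Φ := by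
  have hfac : ∀ p : P, ∃ (Φ : normalDual μ P) (h : M → ℝ), ‖Φ.1‖ ≤ 1 ∧ Integrable h μ ∧
      ∫ x, |h x| ∂μ = ‖(p : StrongDual ℝ E)‖ ∧
      ∀ φ, (p : StrongDual ℝ E) φ = ∫ x, Φ.1.toCLM φ x * h x ∂μ := fun p => by
    obtain ⟨Φ, hΦ, hΦ1, h, hh⟩ := hE.exists_factorization p.2
    exact ⟨⟨Φ, hΦ⟩, h, hΦ1, hh⟩
  choose Φ h hΦ1 hh hhp hp using hfac
  have hbound : ∀ p : P, |∫ x, L (Φ p) x * h p x ∂μ| ≤ C * ‖(p : StrongDual ℝ E)‖ := fun p => by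
    refine (abs_integral_mul_le _ (hh p)).trans ?_
    rw [hhp]
    refine mul_le_mul_of_nonneg_right ((hL _).trans ?_) (norm_nonneg _)
    exact mul_le_of_le_one_right hC (hΦ1 p)
  obtain ⟨φ, hφ⟩ := hE.isPredual.surjective
    { toFun := fun p => ∫ x, L (Φ p) x * h p x ∂μ
      map_add' := fun p q => by
        have := normalDual.sum_integral_map_eq_zero L ![Φ (p + q), Φ p, Φ q]
          (h := ![h (p + q), -h p, -h q])
          (fun i => by fin_cases i; exacts [hh _, (hh _).neg, (hh _).neg]) (fun φ => by
            simp [Fin.sum_univ_three, integral_neg, ← hp])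
        simp [Fin.sum_univ_three, integral_neg] at this
        linarith
      map_smul' := fun c p => by
        have e1 : ∀ f : LInfty μ, ∫ x, f x * (c * h p x) ∂μ = c * ∫ x, f x * h p x ∂μ :=
          fun f => by
            rw [← integral_const_mul]
            exact integral_congr_ae (.of_forall fun x => by ring)
        rw [RingHom.id_apply, smul_eq_mul, ← e1]
        refine normalDual.integral_map_eq L (hh _) ((hh p).const_mul c) fun φ => ?_
        rw [e1, ← hp, ← hp]
        rfl } ⟨C, hbound⟩
  have hφ' : ∀ p : P, (p : StrongDual ℝ E) φ = ∫ x, L (Φ p) x * h p x ∂μ := fun p => (hφ p).symm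
  refine ⟨φ, (hE.isPredual.isometric φ).2 ?_, fun Ψ => eq_of_forall_integral_mul_eq fun g => ?_⟩
  · rintro _ ⟨p, hpP, hp1, rfl⟩
    rw [hφ' ⟨p, hpP⟩]
    exact (hbound ⟨p, hpP⟩).trans (mul_le_of_le_one_right hC hp1)
  · have hm := Ψ.2 (l1ToDual μ g) (l1ToDual_mem g)
    refine Eq.trans (hφ' ⟨_, hm⟩) ?_
    exact normalDual.integral_map_eq L (hh _) (L1.integrable_coeFn g) fun ψ => (hp ⟨_, hm⟩ ψ).symm

theorem ext_normalDual (hE : IsAbelianWStarModule μ P) {φ ψ : E}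
    (h : ∀ Φ ∈ normalDual μ P, Φ.toCLM φ = Φ.toCLM ψ) : φ = ψ :=
  hE.ext_predual fun p hp => by
    obtain ⟨Φ, hΦ, -, k, -, -, hk⟩ := hE.exists_factorization hp
    rw [hk, hk, h Φ hΦ]

end IsAbelianWStarModule

end NormalDual

/-! ### Universality of the exterior derivative -/

section Universal

variable {M : Type u} [MeasurableSpace M] {μ : Measure M} {ρ : MeasurablePseudometric μ}

namespace MeasurablePseudometric

theorem Lip.isClosed_predual : IsClosed (Lip.predual ρ : Set (StrongDual ℝ ρ.Lip)) := by
  refine isClosed_of_closure_subset fun p hp => ?_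
  refine @continuousOn_of_uniform_approx_of_continuousOn ρ.Lip ℝ
    (TopologicalSpace.induced Lip.toLInfty (weakStar (linftyPredual μ))) _
    p (Metric.closedBall 0 1) fun U hU => ?_
  obtain ⟨ε, hε, hεU⟩ := Metric.mem_uniformity_dist.1 hU
  obtain ⟨q, hq, hpq⟩ := Metric.mem_closure_iff.1 hp ε hε
  refine ⟨q, hq, fun f hf => hεU ?_⟩
  rw [mem_closedBall_zero_iff] at hf
  rw [dist_eq_norm] at hpq ⊢
  exact (((p - q).le_opNorm f).trans (mul_le_of_le_one_right (norm_nonneg _) hf)).trans_lt hpq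

theorem norm_extDeriv_le : ‖ρ.extDeriv‖ ≤ 1 :=
  ContinuousLinearMap.opNorm_le_bound _ zero_le_one fun f => by
    rw [one_mul]
    exact ContinuousLinearMap.opNorm_le_bound _ (norm_nonneg f) fun φ => by
      rw [mul_comm]; exact φ.toCLM.le_opNorm f

theorem isMetricDerivation_extDeriv : ρ.IsMetricDerivation ρ.oneFormsPredual ρ.extDeriv where
  continuous := (continuous_weakStar_iff_comp_mem _).2 <|
    DualModule.comp_mem_of_forall_eval Lip.isClosed_predual _ fun φ p hp =>
      (continuous_weakStar_iff_comp_mem φ.toCLM).1 φ.2.continuous p hp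
  leibniz f g := DualModule.ext fun φ => φ.2.leibniz f g

variable {E : Type v} [NormedAddCommGroup E] [NormedSpace ℝ E] [Module (LInfty μ) E]
  {P : Submodule ℝ (StrongDual ℝ E)} {δ : ρ.Lip →L[ℝ] E}

/-- A metric derivation `δ` into `E` pulls back a weak*-continuous homomorphism `Φ : E → L^∞` to
the vector field `Φ ∘ δ`. -/
noncomputable def IsMetricDerivation.pullback (hδ : ρ.IsMetricDerivation P δ) :
    normalDual μ P →ₗ[LInfty μ] ρ.VectorFields where
  toFun Φ := ⟨Φ.1.toCLM.comp δ, (continuous_weakStar_iff_comp_mem _).2 fun q hq =>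
      (continuous_weakStar_iff_comp_mem δ).1 hδ.continuous _ (Φ.2 q hq),
    fun f g => by
      simp only [ContinuousLinearMap.comp_apply, hδ.leibniz, map_add, DualModule.toCLM_smul,
        smul_eq_mul]⟩
  map_add' _ _ := rfl
  map_smul' _ _ := rfl

theorem IsMetricDerivation.norm_pullback_le (hδ : ρ.IsMetricDerivation P δ)
    (Φ : normalDual μ P) : ‖hδ.pullback Φ‖ ≤ ‖Φ.1‖ * ‖δ‖ :=
  ContinuousLinearMap.opNorm_comp_le Φ.1.toCLM δ

/-- The transpose of the pullback along a metric derivation `δ : Lip(M) → E` is a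
weak*-continuous module map from the 1-forms to the dual of the weak*-continuous homomorphisms on
`E`, that is, to `E`. -/
theorem IsMetricDerivation.exists_factor [SigmaFinite μ] (hE : IsAbelianWStarModule μ P)
    (hδ : ρ.IsMetricDerivation P δ) :
    ∃ T : ρ.OneForms →L[ℝ] E, (∀ (h : LInfty μ) (ω : ρ.OneForms), T (h • ω) = h • T ω) ∧
      Continuous[weakStar ρ.oneFormsPredual, weakStar P] T ∧
      (∀ f : ρ.Lip, δ f = T (ρ.extDeriv f)) ∧ ‖T‖ = ‖δ‖ := by
  have hex : ∀ ω : ρ.OneForms, ∃ φ : E, ‖φ‖ ≤ ‖δ‖ * ‖ω‖ ∧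
      ∀ Φ : normalDual μ P, Φ.1.toCLM φ = ω.toCLM (hδ.pullback Φ) := fun ω =>
    hE.exists_eq_apply_of_bounded
      { toFun := fun Φ => ω.toCLM (hδ.pullback Φ)
        map_add' := fun Φ Ψ => by rw [map_add, map_add]
        map_smul' := fun f Φ => by
          rw [map_smul, DualModule.toCLM_smul, RingHom.id_apply, smul_eq_mul] }
      (mul_nonneg (norm_nonneg δ) (norm_nonneg ω)) fun Φ => by
        refine (ω.toCLM.le_opNorm _).trans ?_
        rw [DualModule.norm_toCLM]
        calc ‖ω‖ * ‖hδ.pullback Φ‖ ≤ ‖ω‖ * (‖Φ.1‖ * ‖δ‖) :=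
              mul_le_mul_of_nonneg_left (hδ.norm_pullback_le Φ) (norm_nonneg ω)
          _ = ‖δ‖ * ‖ω‖ * ‖Φ.1‖ := by ring
  choose τ hτn hτ using hex
  have hτ' : ∀ ω, ∀ Φ (hΦ : Φ ∈ normalDual μ P), Φ.toCLM (τ ω) = ω.toCLM (hδ.pullback ⟨Φ, hΦ⟩) :=
    fun ω Φ hΦ => hτ ω ⟨Φ, hΦ⟩
  let T : ρ.OneForms →L[ℝ] E := LinearMap.mkContinuous
    { toFun := τ
      map_add' := fun ω ν => hE.ext_normalDual fun Φ hΦ => by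
        rw [map_add, hτ' _ Φ hΦ, hτ' _ Φ hΦ, hτ' _ Φ hΦ]
        rfl
      map_smul' := fun c ω => hE.ext_normalDual fun Φ hΦ => by
        rw [RingHom.id_apply, map_smul, hτ' _ Φ hΦ, hτ' _ Φ hΦ]
        rfl } ‖δ‖ hτn
  have hT : ∀ ω, T ω = τ ω := fun _ => rfl
  have hTd : ∀ f : ρ.Lip, δ f = T (ρ.extDeriv f) := fun f => hE.ext_normalDual fun Φ hΦ => by
    rw [hT, hτ' _ Φ hΦ]
    rfl
  refine ⟨T, fun h ω => hE.ext_normalDual fun Φ hΦ => ?_, ?_, hTd, le_antisymm ?_ ?_⟩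
  · rw [hT, hT, DualModule.toCLM_smul, hτ' _ Φ hΦ, hτ' _ Φ hΦ]
    rfl
  · refine (continuous_weakStar_iff_comp_mem T).2 fun p hp => ?_
    obtain ⟨Φ, hΦ, -, h, hh, -, hp⟩ := hE.exists_factorization hp
    have hq : l1ToDual μ (hh.toL1 h) ∈ linftyPredual μ := l1ToDual_mem _
    have heq : p.comp T = (l1ToDual μ (hh.toL1 h)).comp
        (DualModule.eval μ (hδ.pullback ⟨Φ, hΦ⟩)) := ContinuousLinearMap.ext fun ω => by
      refine (hp (τ ω)).trans ?_
      rw [hτ' _ Φ hΦ]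
      refine integral_congr_ae ?_
      filter_upwards [hh.coeFn_toL1] with x hx
      rw [hx]
      rfl
    exact heq ▸ DualModule.comp_eval_mem _ hq
  · exact ContinuousLinearMap.opNorm_le_bound _ (norm_nonneg δ) hτn
  · refine ContinuousLinearMap.opNorm_le_bound _ (norm_nonneg T) fun f => ?_
    rw [hTd]
    refine (T.le_opNorm _).trans (mul_le_mul_of_nonneg_left ?_ (norm_nonneg T))
    exact (ρ.extDeriv.le_opNorm f).trans (mul_le_of_le_one_left (norm_nonneg f) norm_extDeriv_le)

end MeasurablePseudometric

end Universal

end MeasMetric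

theorem theorem23 {M : Type*} [MeasurableSpace M] (μ : Measure M) [SigmaFinite μ]
    (ρ : MeasurablePseudometric μ) (hρ : ρ.IsMetric) :
    -- `Ω(M)` is an abelian W*-module, and `d` is a metric derivation into it
    IsAbelianWStarModule μ ρ.oneFormsPredual ∧
    ρ.IsMetricDerivation ρ.oneFormsPredual ρ.extDeriv ∧
    -- `d` is universal among metric derivations into abelian W*-modules
    ∀ (E : Type*) [NormedAddCommGroup E] [NormedSpace ℝ E] [Module (LInfty μ) E]
      (P : Submodule ℝ (StrongDual ℝ E)), IsAbelianWStarModule μ P →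
      ∀ δ : ρ.Lip →L[ℝ] E, ρ.IsMetricDerivation P δ →
        ∃ T : ρ.OneForms →L[ℝ] E,
          (∀ (h : LInfty μ) (ω : ρ.OneForms), T (h • ω) = h • T ω) ∧
          Continuous[weakStar ρ.oneFormsPredual, weakStar P] T ∧
          (∀ f : ρ.Lip, δ f = T (ρ.extDeriv f)) ∧
          ‖T‖ = ‖δ‖ :=
  ⟨DualModule.isAbelianWStarModule, MeasurablePseudometric.isMetricDerivation_extDeriv,
    fun _ _ _ _ _ hE _ hδ => hδ.exists_factor hE⟩
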